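/- Let $q\ge 3$ and $\delta\ge 0$ be integers. A $(\sigma,\delta)$-hub of a graph $G$ is a set $Q\subseteq V(G)$ such that every connected component of $G-Q$ has at most $\sigma$ vertices and is adjacent in $G$ to at most $\delta$ vertices of $Q$. List $q$-Coloring asks, given a graph $G$ and lists $L(v)\subseteq\{1,\dots,q\}$ for $v\in V(G)$, for a proper coloring $\varphi$ of $G$ with $\varphi(v)\in L(v)$ for all $v$, or for the answer that there is none. Running times are counted in steps of a deterministic word RAM with words of $O(\log n)$ bits (one fixed program, depending only on $q,\sigma,\delta$). (1) There is $\varepsilon>0$, depending only on $q$ and $\delta$, such that for every integer $\sigma\ge 0$, List $q$-Coloring on $n$-vertex graphs given together with a $(\sigma,\delta)$-hub of size $p$ can be solved in time $(q-\varepsilon)^p\cdot n^{O(1)}$. (2) If $\delta\ge 1$, then for every integer $\sigma\ge 0$, this problem can be solved in time $(q^\delta-1)^{p/\delta}\cdot n^{O(1)}$. The constants hidden in $n^{O(1)}$ may depend on $q$, $\sigma$ and $\delta$; for $n\le 1$, $n^{O(1)}$ is read as $O(1)$. -/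

import Mathlib

/-! ### Word RAM: structured programs, running time, word size -/

namespace WordRAM

/-- A memory state: registers `reg r`, and arrays `arr a` whose cells `arr a i` are addressed
indirectly. A fixed program mentions only finitely many registers and arrays. -/
structure State where
  reg : ℕ → ℕ
  arr : ℕ → ℕ → ℕ

/-- Expressions: constants, register reads, array reads `arr a [i]`, and the usual word
operations. Subtraction is truncated at `0`, division and remainder are those of `ℕ`, and the two
comparisons return `1` for true and `0` for false. -/
inductive Expr where
  | const (k : ℕ)
  | reg (r : ℕ)
  | get (a : ℕ) (i : Expr)
  | add (x y : Expr)
  | sub (x y : Expr)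
  | mul (x y : Expr)
  | div (x y : Expr)
  | mod (x y : Expr)
  | lt (x y : Expr)
  | eq (x y : Expr)

/-- The value of an expression in a state. -/
def Expr.eval (s : State) : Expr → ℕ
  | .const k => k
  | .reg r => s.reg r
  | .get a i => s.arr a (i.eval s)
  | .add x y => x.eval s + y.eval s
  | .sub x y => x.eval s - y.eval s
  | .mul x y => x.eval s * y.eval s
  | .div x y => x.eval s / y.eval s
  | .mod x y => x.eval s % y.eval s
  | .lt x y => if x.eval s < y.eval s then 1 else 0
  | .eq x y => if x.eval s = y.eval s then 1 else 0

/-- The evaluation of an expression in a state causes no overflow when a word holds the numbers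
below `W`. Only constants, sums and products can leave this range: the other operations never
exceed their operands (or `1`), and everything read from the memory is already a word. -/
def Expr.Fits (W : ℕ) (s : State) : Expr → Prop
  | .const k => k < W
  | .reg _ => True
  | .get _ i => i.Fits W s
  | .add x y => x.Fits W s ∧ y.Fits W s ∧ x.eval s + y.eval s < W
  | .sub x y => x.Fits W s ∧ y.Fits W s
  | .mul x y => x.Fits W s ∧ y.Fits W s ∧ x.eval s * y.eval s < W
  | .div x y => x.Fits W s ∧ y.Fits W s
  | .mod x y => x.Fits W s ∧ y.Fits W s
  | .lt x y => x.Fits W s ∧ y.Fits W s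
  | .eq x y => x.Fits W s ∧ y.Fits W s

/-- The time for evaluating an expression: one step for each of its operations. -/
def Expr.cost : Expr → ℕ
  | .const _ => 1
  | .reg _ => 1
  | .get _ i => i.cost + 1
  | .add x y => x.cost + y.cost + 1
  | .sub x y => x.cost + y.cost + 1
  | .mul x y => x.cost + y.cost + 1
  | .div x y => x.cost + y.cost + 1
  | .mod x y => x.cost + y.cost + 1
  | .lt x y => x.cost + y.cost + 1
  | .eq x y => x.cost + y.cost + 1

/-- Programs: do nothing, assign to a register, store into an array cell, sequential composition,
conditional, and loop. A test succeeds if its value is not `0`. -/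
inductive Program where
  | nop
  | assign (r : ℕ) (e : Expr)
  | store (a : ℕ) (i e : Expr)
  | seq (P R : Program)
  | branch (e : Expr) (P R : Program)
  | loop (e : Expr) (P : Program)

/-- The state after writing `x` into the register `r`. -/
def State.setReg (s : State) (r x : ℕ) : State :=
  { s with reg := Function.update s.reg r x }

/-- The state after writing `x` into cell `i` of the array `a`. -/
def State.setArr (s : State) (a i x : ℕ) : State :=
  { s with arr := Function.update s.arr a (Function.update (s.arr a) i x) }

/-- `Exec W P s t s'`: on a machine whose words hold the numbers below `W`, the program `P`,
started in the state `s`, halts after exactly `t` steps in the state `s'`, and no operation on the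
way overflows a word. -/
inductive Exec (W : ℕ) : Program → State → ℕ → State → Prop where
  | nop (s : State) : Exec W .nop s 1 s
  | assign (s : State) (r : ℕ) (e : Expr) (he : e.Fits W s) :
      Exec W (.assign r e) s (e.cost + 1) (s.setReg r (e.eval s))
  | store (s : State) (a : ℕ) (i e : Expr) (hi : i.Fits W s) (he : e.Fits W s) :
      Exec W (.store a i e) s (i.cost + e.cost + 1) (s.setArr a (i.eval s) (e.eval s))
  | seq {P R : Program} {s s₁ s₂ : State} {t₁ t₂ : ℕ}
      (hP : Exec W P s t₁ s₁) (hR : Exec W R s₁ t₂ s₂) : Exec W (.seq P R) s (t₁ + t₂) s₂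
  | branch_true {e : Expr} {P R : Program} {s s' : State} {t : ℕ} (hf : e.Fits W s)
      (he : e.eval s ≠ 0) (hP : Exec W P s t s') : Exec W (.branch e P R) s (e.cost + 1 + t) s'
  | branch_false {e : Expr} {P R : Program} {s s' : State} {t : ℕ} (hf : e.Fits W s)
      (he : e.eval s = 0) (hR : Exec W R s t s') : Exec W (.branch e P R) s (e.cost + 1 + t) s'
  | loop_done {e : Expr} {P : Program} {s : State} (hf : e.Fits W s)
      (he : e.eval s = 0) : Exec W (.loop e P) s (e.cost + 1) s
  | loop_step {e : Expr} {P : Program} {s s₁ s₂ : State} {t₁ t₂ : ℕ} (hf : e.Fits W s)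
      (he : e.eval s ≠ 0) (hP : Exec W P s t₁ s₁) (hloop : Exec W (.loop e P) s₁ t₂ s₂) :
      Exec W (.loop e P) s (e.cost + 1 + t₁ + t₂) s₂

end WordRAM

/-! ### List colouring of graphs given with a hub -/

namespace HubColoring

/-- `Q` is a `(σ, δ)`-hub of `G`: every connected component of `G - Q` has at most `σ` vertices
and is adjacent to at most `δ` vertices of `Q`. -/
def IsHub {V : Type*} [Finite V] (G : SimpleGraph V) (σ δ : ℕ) (Q : Finset V) : Prop :=
  ∀ C : (G.induce ((Q : Set V)ᶜ)).ConnectedComponent,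
    C.supp.ncard ≤ σ ∧ {x : V | x ∈ Q ∧ ∃ v ∈ C.supp, G.Adj x (v : V)}.ncard ≤ δ

/-- `φ` respects the lists `L`; properness is part of `G.Coloring`. -/
def IsListColoring {V : Type*} {q : ℕ} {G : SimpleGraph V} (L : V → Finset (Fin q))
    (φ : G.Coloring (Fin q)) : Prop :=
  ∀ v, φ v ∈ L v

open Classical in
/-- The input state for a graph `G` on `0, …, n-1` with lists `L` and a vertex set `Q`.
Register `0` holds `n`; array `0` is the adjacency matrix of `G` (entry `u, v` in cell
`u * n + v`), array `1` the 0/1-table of the lists (entry `v, k` in cell `v * q + k`), array `2`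
the indicator of `Q`. Everything else is `0`. -/
noncomputable def inputState {n q : ℕ} (G : SimpleGraph (Fin n)) (L : Fin n → Finset (Fin q))
    (Q : Finset (Fin n)) : WordRAM.State where
  reg := fun r => if r = 0 then n else 0
  arr := fun a i =>
    if a = 0 then (if ∃ u v : Fin n, i = u * n + v ∧ G.Adj u v then 1 else 0)
    else if a = 1 then
      (if ∃ (v : Fin n) (k : Fin q), i = (v : ℕ) * q + k ∧ k ∈ L v then 1 else 0)
    else if a = 2 then (if ∃ v : Fin n, i = v ∧ v ∈ Q then 1 else 0)
    else 0

/-- The final state answers the instance `(G, L)`: either register `0` holds `1` and array `0`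
holds a proper list colouring, or there is none and register `0` holds `0`. -/
def IsAnswer {n q : ℕ} (G : SimpleGraph (Fin n)) (L : Fin n → Finset (Fin q))
    (s : WordRAM.State) : Prop :=
  (s.reg 0 = 1 ∧ ∃ φ : G.Coloring (Fin q), IsListColoring L φ ∧ ∀ v : Fin n, s.arr 0 v = φ v) ∨
  (s.reg 0 = 0 ∧ ¬ ∃ φ : G.Coloring (Fin q), IsListColoring L φ)

/-- List `q`-Colouring on `n`-vertex graphs given with a `(σ, δ)`-hub of size `p` can be solved in
time `f p * n ^ O(1)` on a word RAM with words of `O(log n)` bits (holding the numbers below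
`(n + 2) ^ c`): one program and one exponent `c` serve all instances. Writing `n + 2` for `n`
only matters for `n ≤ 1`. -/
def SolvableInTime (q σ δ : ℕ) (f : ℕ → ℝ) : Prop :=
  ∃ (P : WordRAM.Program) (c : ℕ),
    ∀ (n : ℕ) (G : SimpleGraph (Fin n)) (L : Fin n → Finset (Fin q)) (Q : Finset (Fin n)),
      IsHub G σ δ Q →
      ∃ (t : ℕ) (s : WordRAM.State),
        WordRAM.Exec ((n + 2) ^ c) P (inputState G L Q) t s ∧
        (t : ℝ) ≤ f Q.card * ((n : ℝ) + 2) ^ c ∧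
        IsAnswer G L s

end HubColoring

/-! The algorithm is a backtracking search over partial colourings, pruned by polynomial tests that
look only a constant number of vertices ahead.

`Ext σ` is a game version of extendability: any σ vertices, presented one by one, can be coloured
consistently. It is necessary for a list colouring extending `col` (`HasExt.ext`), and it suffices
to colour any one component of G - Q, since such a component has at most σ vertices. `Live σ k` asks
for `Ext σ` after every way of giving arbitrary colours to k uncoloured hub vertices. For fixed q,
σ, δ these tests take polynomial time.

If level 0 fails, the node is abandoned. If all levels k ≤ δ are live, then, because a component
sees at most δ hub vertices, every proper list colouring of the hub that agrees with `col` extends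
to all components (`exists_listColoring_of_live`). Level 1 moreover makes the lists of uncoloured
hub vertices full and cuts these vertices off from the coloured ones. Permuting colours on the
uncoloured part of the hub then shows that one colour is as good as another
(`HasExt.update_of_live`), so a single child is tried. Otherwise let k + 1 ≤ δ be the first failing
level. Some uncoloured hub vertex v has a colour after which level k fails; the search branches on
all q colours of v.

The tree is measured by a potential. With h uncoloured hub vertices and first failing level m it is
(q^m - 1) y^(h-m), and it is y^h if no level up to δ fails. In the branching case one child is worth
at most (q^k - 1) y^(h-1-k) and the q - 1 others at most y^(h-1) each. Since y ≤ q, the total is at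
most (q^(k+1) - 1) y^(h-k-1), the potential of the parent (`sum_bound_le`). Comparing the potential
with y^h needs q^k - 1 ≤ y^k for k ≤ δ, and y = (q^δ - 1)^(1/δ) < q satisfies this (`isBase_base`).

Once the hub is coloured, `Ext σ` is equivalent to extendability (`hasExt_of_ext`), so colouring the
remaining vertices never backtracks over more than a dead child. `search_node` combines these facts
into a step count, and `solvableInTime_of_isBase` turns it into a running time. -/

namespace WordRAM

/-! ### Hoare-style rules with time bounds for word RAM programs. -/

/-- Started in `s`, the program `P` halts within `T` steps in a state satisfying `post`. -/
def Runs (W T : ℕ) (P : Program) (s : State) (post : State → Prop) : Prop :=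
  ∃ t s', Exec W P s t s' ∧ t ≤ T ∧ post s'

namespace Runs

variable {W T T₁ T₂ : ℕ} {P R : Program} {s : State} {post post' mid : State → Prop} {e i : Expr}

lemma mono (h : Runs W T₁ P s post) (hT : T₁ ≤ T) (hp : ∀ s', post s' → post' s') :
    Runs W T P s post' := by
  obtain ⟨t, s', h1, h2, h3⟩ := h
  exact ⟨t, s', h1, h2.trans hT, hp _ h3⟩

lemma weaken (h : Runs W T₁ P s post) (hT : T₁ ≤ T) : Runs W T P s post :=
  h.mono hT fun _ => id

lemma nop (h : post s) : Runs W 1 .nop s post := ⟨1, s, .nop s, le_rfl, h⟩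

lemma assign {r : ℕ} (he : e.Fits W s) (h : post (s.setReg r (e.eval s))) :
    Runs W (e.cost + 1) (.assign r e) s post := ⟨_, _, .assign s r e he, le_rfl, h⟩

lemma store {a : ℕ} (hi : i.Fits W s) (he : e.Fits W s)
    (h : post (s.setArr a (i.eval s) (e.eval s))) :
    Runs W (i.cost + e.cost + 1) (.store a i e) s post :=
  ⟨_, _, .store s a i e hi he, le_rfl, h⟩

lemma seq (hP : Runs W T₁ P s mid) (hR : ∀ s₁, mid s₁ → Runs W T₂ R s₁ post) :
    Runs W (T₁ + T₂) (.seq P R) s post := by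
  obtain ⟨t, s', h1, h2, h3⟩ := hP
  obtain ⟨t', s'', h1', h2', h3'⟩ := hR _ h3
  exact ⟨_, _, .seq h1 h1', by omega, h3'⟩

lemma branch (hf : e.Fits W s) (h₁ : e.eval s ≠ 0 → Runs W T P s post)
    (h₀ : e.eval s = 0 → Runs W T R s post) : Runs W (e.cost + 1 + T) (.branch e P R) s post := by
  by_cases he : e.eval s = 0
  · obtain ⟨t, s', h1, h2, h3⟩ := h₀ he
    exact ⟨_, _, .branch_false hf he h1, by omega, h3⟩
  · obtain ⟨t, s', h1, h2, h3⟩ := h₁ he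
    exact ⟨_, _, .branch_true hf he h1, by omega, h3⟩

end Runs

/-- `for r := 0, …, e - 1 do P`. -/
def forLoop (r : ℕ) (e : Expr) (P : Program) : Program :=
  .seq (.assign r (.const 0))
    (.loop (.lt (.reg r) e) (.seq P (.assign r (.add (.reg r) (.const 1)))))

/-- The bound `e` is evaluated anew in every round, so the invariant has to fix its value. The body
must leave the counter alone; `I (i + 1)` is required only after the increment. -/
lemma Runs.forLoop {W T N r : ℕ} {e : Expr} {P : Program} {s : State} {post : State → Prop}
    (I : ℕ → State → Prop) (hW : N < W) (h0 : I 0 (s.setReg r 0))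
    (hb : ∀ i s, I i s → e.Fits W s ∧ e.eval s = N) (hr : ∀ i s, I i s → s.reg r = i)
    (hstep : ∀ i < N, ∀ s, I i s →
      Runs W T P s (fun s' => s'.reg r = i ∧ I (i + 1) (s'.setReg r (i + 1))))
    (hpost : ∀ s, I N s → post s) :
    Runs W (N * (T + e.cost + 7) + e.cost + 5) (WordRAM.forLoop r e P) s post := by
  have key : ∀ m i, i + m = N → ∀ s, I i s → Runs W (m * (T + e.cost + 7) + e.cost + 3)
      (.loop (.lt (.reg r) e) (.seq P (.assign r (.add (.reg r) (.const 1))))) s post := by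
    intro m
    induction m with
    | zero =>
      intro i hi s hs
      obtain rfl : i = N := by omega
      refine ⟨_, s, .loop_done ⟨trivial, (hb _ _ hs).1⟩ ?_, ?_, hpost _ hs⟩
      · simp [Expr.eval, hr _ _ hs, (hb _ _ hs).2]
      · simp only [Expr.cost]; omega
    | succ m ih =>
      intro i hi s hs
      obtain ⟨t₁, s₁, e1, ht₁, hri, hI⟩ := hstep i (by omega) s hs
      obtain ⟨t₂, s₂, e2, ht₂, hp⟩ := ih (i + 1) (by omega) _ hI
      have e3 : Exec W (.assign r (.add (.reg r) (.const 1))) s₁ 4 (s₁.setReg r (i + 1)) := by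
        have := Exec.assign (W := W) s₁ r (.add (.reg r) (.const 1))
          ⟨trivial, by simp only [Expr.Fits]; omega, by simp only [Expr.eval, hri]; omega⟩
        simpa [Expr.eval, Expr.cost, hri] using this
      refine ⟨_, s₂, .loop_step ⟨trivial, (hb _ _ hs).1⟩ ?_ (.seq e1 e3) e2, ?_, hp⟩
      · simp only [Expr.eval, hr _ _ hs, (hb _ _ hs).2]
        rw [if_pos (by omega)]; simp
      · have : (m + 1) * (T + e.cost + 7) = m * (T + e.cost + 7) + (T + e.cost + 7) := by ring
        simp only [Expr.cost]; omega
  have h := Runs.seq (W := W) (T₁ := 2) (P := .assign r (.const 0)) (s := s)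
    (mid := I 0) (Runs.assign (by simp only [Expr.Fits]; omega) (by simpa [Expr.eval] using h0))
    (key N 0 (by omega))
  exact h.weaken (by omega)

end WordRAM

/-! ### Partial colourings, the extension game and the levels of liveness. -/

namespace HubColoring

open WordRAM

/-- An instance of List `q`-Colouring together with a vertex set. -/
structure Instance (q : ℕ) where
  n : ℕ
  G : SimpleGraph (Fin n)
  L : Fin n → Finset (Fin q)
  Q : Finset (Fin n)

namespace Instance

variable {q : ℕ} (I : Instance q)

/-- The input state of the instance. -/
noncomputable def input : State := inputState I.G I.L I.Q

/-- Indicator of the vertex set `Q`. -/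
noncomputable def hub (v : ℕ) : ℕ := I.input.arr 2 v

/-- A partial colouring is a map `col : ℕ → ℕ`, where `0` means uncoloured and `c + 1` stands for
the colour `c`. It is consistent if the coloured vertices respect lists and edges. -/
def Cons (col : ℕ → ℕ) : Prop :=
  ∀ u : Fin I.n, col u ≠ 0 →
    (∃ k ∈ I.L u, col u = (k : ℕ) + 1) ∧ ∀ v, I.G.Adj u v → col u ≠ col v

open Classical in
/-- The vertex `v` is uncoloured, its hub indicator is at least `thrQ`, and fewer than `thr` of
its colours lead to a partial colouring with property `p`. -/
def Fails (thr thrQ : ℕ) (p : (ℕ → ℕ) → Prop) (col : ℕ → ℕ) (v : ℕ) : Prop :=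
  v < I.n ∧ col v = 0 ∧ thrQ ≤ I.hub v ∧
    ((Finset.range q).filter fun c => p (Function.update col v (c + 1))).card < thr

/-- Winning position in the game in which `j` times a vertex is presented and has to be coloured
consistently. -/
def Ext : ℕ → (ℕ → ℕ) → Prop
  | 0, col => I.Cons col
  | j + 1, col => Ext j col ∧ ∀ v, ¬ I.Fails 1 0 (Ext j) col v

/-- Every way of colouring `k` further hub vertices leads to a winning position. -/
def Live (σ : ℕ) : ℕ → (ℕ → ℕ) → Prop
  | 0, col => I.Ext σ col
  | k + 1, col => ∀ v, ¬ I.Fails q 1 (Live σ k) col v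

/-- `φ` extends the partial colouring `col`. -/
def Extends (col : ℕ → ℕ) (φ : Fin I.n → Fin q) : Prop :=
  ∀ v : Fin I.n, col v ≠ 0 → col v = (φ v : ℕ) + 1

/-- A list colouring extending `col` exists. -/
def HasExt (col : ℕ → ℕ) : Prop :=
  ∃ φ : I.G.Coloring (Fin q), IsListColoring I.L φ ∧ I.Extends col φ

variable {I}

lemma hub_eq (v : Fin I.n) [Decidable (v ∈ I.Q)] : I.hub v = if v ∈ I.Q then 1 else 0 := by
  unfold hub input inputState
  simp only [show (2 : ℕ) ≠ 0 by decide, show (2 : ℕ) ≠ 1 by decide, if_false, if_true]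
  congr 1
  simp only [eq_iff_iff]
  constructor
  · rintro ⟨u, h, hu⟩
    rwa [Fin.ext h]
  · exact fun h => ⟨v, rfl, h⟩

lemma one_le_hub (v : Fin I.n) : 1 ≤ I.hub v ↔ v ∈ I.Q := by
  classical
  rw [hub_eq]; split_ifs <;> simp_all

/-- The threshold expresses both quantifiers over colours by one count: threshold `q` detects a
single bad colour, threshold `1` detects that all colours are bad. -/
lemma fails_full_iff {p : (ℕ → ℕ) → Prop} {col : ℕ → ℕ} {v : ℕ} :
    I.Fails q 1 p col v ↔ v < I.n ∧ col v = 0 ∧ 1 ≤ I.hub v ∧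
      ∃ c < q, ¬ p (Function.update col v (c + 1)) := by
  classical
  unfold Fails
  refine and_congr_right fun _ => and_congr_right fun _ => and_congr_right fun _ => ?_
  constructor
  · intro h
    by_contra! hc
    rw [Finset.filter_true_of_mem (by simpa using hc)] at h
    simp at h
  · rintro ⟨c, hc, hp⟩
    refine lt_of_lt_of_eq (Finset.card_lt_card (Finset.filter_ssubset.2 ⟨c, by simpa using hc, hp⟩))
      (Finset.card_range q)

lemma fails_one_iff {thrQ : ℕ} {p : (ℕ → ℕ) → Prop} {col : ℕ → ℕ} {v : ℕ} :
    I.Fails 1 thrQ p col v ↔ v < I.n ∧ col v = 0 ∧ thrQ ≤ I.hub v ∧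
      ∀ c < q, ¬ p (Function.update col v (c + 1)) := by
  classical
  unfold Fails
  refine and_congr_right fun _ => and_congr_right fun _ => and_congr_right fun _ => ?_
  rw [Nat.lt_one_iff, Finset.card_eq_zero, Finset.filter_eq_empty_iff]
  simp

lemma Ext.cons {j : ℕ} {col : ℕ → ℕ} (h : I.Ext j col) : I.Cons col := by
  induction j generalizing col with
  | zero => exact h
  | succ j ih => exact ih h.1

lemma Extends.update {col : ℕ → ℕ} {φ : Fin I.n → Fin q} (h : I.Extends col φ) (v : Fin I.n) :
    I.Extends (Function.update col v (φ v + 1)) φ := by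
  intro u hu
  by_cases huv : u = v
  · subst huv; simp
  · have : (u : ℕ) ≠ v := fun h => huv (Fin.ext h)
    rw [Function.update_of_ne this] at hu ⊢
    exact h u hu

/-- A list colouring is a strategy for any number of rounds: answer each presented vertex with its
colour under φ. -/
lemma HasExt.ext {col : ℕ → ℕ} (h : I.HasExt col) (j : ℕ) : I.Ext j col := by
  obtain ⟨φ, hL, hφ⟩ := h
  induction j generalizing col with
  | zero =>
    intro u hu
    refine ⟨⟨φ u, hL u, hφ u hu⟩, fun v huv he => φ.valid huv (Fin.ext ?_)⟩
    have h1 := hφ u hu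
    have h2 := hφ v (he ▸ hu)
    omega
  | succ j ih =>
    refine ⟨ih hφ, fun v hv => ?_⟩
    obtain ⟨hn, h0, -, hc⟩ := fails_one_iff.1 hv
    exact hc (φ ⟨v, hn⟩) (φ ⟨v, hn⟩).2 (ih (hφ.update ⟨v, hn⟩))

/-- The uncoloured vertices of `S` are presented one after the other; each uses up one round. -/
lemma Ext.exists_extension {j : ℕ} {col : ℕ → ℕ} (h : I.Ext j col) (S : Finset ℕ)
    (hS : ∀ v ∈ S, v < I.n) (hj : S.card ≤ j) :
    ∃ col', (∀ v, col v ≠ 0 → col' v = col v) ∧ (∀ v ∈ S, col' v ≠ 0) ∧ I.Cons col' := by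
  induction j generalizing col S with
  | zero =>
    have : S = ∅ := by simpa using hj
    exact ⟨col, fun _ _ => rfl, by simp [this], h⟩
  | succ j ih =>
    by_cases hv : ∀ v ∈ S, col v ≠ 0
    · exact ⟨col, fun _ _ => rfl, hv, h.cons⟩
    push Not at hv
    obtain ⟨v, hvS, hv0⟩ := hv
    have h2 := h.2 v
    rw [fails_one_iff] at h2
    push Not at h2
    obtain ⟨c, -, hc⟩ := h2 (hS v hvS) hv0 (Nat.zero_le _)
    obtain ⟨col', h1, h2, h3⟩ := ih hc (S.erase v) (fun u hu => hS u (Finset.mem_of_mem_erase hu))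
      (by rw [Finset.card_erase_of_mem hvS]; omega)
    have key : col' v = c + 1 := by simpa using h1 v (by simp)
    refine ⟨col', fun u hu => ?_, fun u hu => ?_, h3⟩
    · have huv : u ≠ v := by rintro rfl; exact hu hv0
      simpa [huv] using h1 u (by simpa [huv] using hu)
    · by_cases huv : u = v
      · subst huv; omega
      · exact h2 u (Finset.mem_erase.2 ⟨huv, hu⟩)

open Classical in
/-- Overwriting `col` on `X` by the colours of `γ`. -/
noncomputable def overlay (col γ : ℕ → ℕ) (X : Finset ℕ) : ℕ → ℕ :=
  fun v => if v ∈ X then γ v + 1 else col v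

/-- The vertices of `X` are coloured by γ one at a time, each step lowering the level by one. The
size of `X` must equal the level, because `Live σ k` speaks of exactly `k` further vertices and may
hold vacuously. -/
lemma Live.overlay {σ k : ℕ} {col γ : ℕ → ℕ} (h : I.Live σ k col) (X : Finset ℕ)
    (hX : ∀ v ∈ X, v < I.n ∧ col v = 0 ∧ 1 ≤ I.hub v) (hγ : ∀ v ∈ X, γ v < q)
    (hk : X.card = k) : I.Ext σ (overlay col γ X) := by
  induction k generalizing col X with
  | zero =>
    have : X = ∅ := by simpa using hk
    subst this
    have : Instance.overlay col γ ∅ = col := by funext v; simp [Instance.overlay]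
    rw [this]; exact h
  | succ k ih =>
    obtain ⟨v, hv⟩ : X.Nonempty := Finset.card_pos.1 (by omega)
    have h2 := h v
    rw [fails_full_iff] at h2
    push Not at h2
    have h3 := h2 (hX v hv).1 (hX v hv).2.1 (hX v hv).2.2 (γ v) (hγ v hv)
    have h4 := ih h3 (X.erase v) (fun u hu => by
      have hu' := Finset.mem_erase.1 hu
      have := hX u hu'.2
      simpa [hu'.1] using this) (fun u hu => hγ u (Finset.mem_of_mem_erase hu))
      (by rw [Finset.card_erase_of_mem hv]; omega)
    convert h4 using 1
    funext u
    by_cases huv : u = v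
    · subst huv; simp [Instance.overlay, hv]
    · simp [Instance.overlay, huv]

/-- If all positions reached by colouring at most `δ` further hub vertices are winning, then every
colouring of the hub compatible with `col` extends to a list colouring that extends `col`. -/
lemma exists_listColoring_of_live {σ δ : ℕ} (hI : IsHub I.G σ δ I.Q) {col : ℕ → ℕ}
    (hlive : ∀ k ≤ δ, I.Live σ k col) (γ : Fin I.n → Fin q)
    (hγ : ∀ v ∈ I.Q, col v ≠ 0 → col v = (γ v : ℕ) + 1) (hγL : ∀ v ∈ I.Q, γ v ∈ I.L v)
    (hγG : ∀ u ∈ I.Q, ∀ v ∈ I.Q, I.G.Adj u v → γ u ≠ γ v) :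
    ∃ φ : I.G.Coloring (Fin q), IsListColoring I.L φ ∧ I.Extends col φ ∧ ∀ v ∈ I.Q, φ v = γ v := by
  classical
  let γ' : ℕ → ℕ := fun v => if h : v < I.n then γ ⟨v, h⟩ else 0
  have hγ' : ∀ v : Fin I.n, γ' v = γ v := fun v => by simp [γ']
  have key : ∀ C : (I.G.induce ((I.Q : Set (Fin I.n))ᶜ)).ConnectedComponent,
      ∃ f : Fin I.n → Fin q, (∀ v ∈ C.supp,
        col (v : Fin I.n) ≠ 0 → col (v : Fin I.n) = (f v : ℕ) + 1) ∧
        (∀ v ∈ C.supp, f v ∈ I.L v) ∧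
        (∀ u ∈ C.supp, ∀ v ∈ C.supp, I.G.Adj u v → f u ≠ f v) ∧
        ∀ u ∈ C.supp, ∀ v ∈ I.Q, I.G.Adj u v → f u ≠ γ v := by
    intro C
    obtain ⟨hC, hN⟩ := hI C
    set N : Finset (Fin I.n) :=
      Finset.univ.filter fun x => x ∈ I.Q ∧ ∃ v ∈ C.supp, I.G.Adj x (v : Fin I.n) with hNdef
    have hNcard : N.card ≤ δ := by
      rw [← Set.ncard_coe_finset]
      simpa [hNdef] using hN
    -- `X` is the uncoloured part of the hub neighbourhood `N` of `C`. It has at most δ elements, so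
    -- the hypothesis applies at level `X.card`, with γ as the colouring of `X`.
    set X : Finset ℕ := (N.filter fun x : Fin I.n => col (x : ℕ) = 0).image Fin.val with hXdef
    have hXcard : X.card ≤ δ :=
      Finset.card_image_le.trans ((Finset.card_filter_le _ _).trans hNcard)
    have hX : ∀ v ∈ X, v < I.n ∧ col v = 0 ∧ 1 ≤ I.hub v := by
      intro v hv
      obtain ⟨x, hx, rfl⟩ := Finset.mem_image.1 hv
      have hx := Finset.mem_filter.1 hx
      exact ⟨x.2, hx.2, (one_le_hub x).2 (by simpa [hNdef] using (Finset.mem_filter.1 hx.1).2.1)⟩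
    have hext := (hlive X.card hXcard).overlay (γ := γ') X hX
      (fun v hv => by simp only [γ', (hX v hv).1, dif_pos]; exact Fin.isLt _) rfl
    -- The component has at most σ vertices, so the σ rounds of the game colour all of it.
    set S : Finset ℕ := C.supp.toFinset.image
      (fun v : ((I.Q : Set (Fin I.n))ᶜ : Set (Fin I.n)) => ((v : Fin I.n) : ℕ)) with hSdef
    obtain ⟨col', h1, h2, h3⟩ := hext.exists_extension S
      (fun v hv => by obtain ⟨x, -, rfl⟩ := Finset.mem_image.1 hv; exact Fin.isLt _)
      (Finset.card_image_le.trans (by rwa [← Set.ncard_eq_toFinset_card']))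
    have hne : ∀ v ∈ C.supp, col' (v : Fin I.n) ≠ 0 := fun v hv =>
      h2 _ (Finset.mem_image.2 ⟨v, by simpa using hv, rfl⟩)
    -- Where `col'` is uncoloured, `γ v` merely supplies some element of `Fin q`.
    have hf : ∀ v : Fin I.n, ∃ k : Fin q, col' v ≠ 0 → k ∈ I.L v ∧ col' v = (k : ℕ) + 1 := by
      intro v
      by_cases hv : col' v = 0
      · exact ⟨γ v, fun h => absurd hv h⟩
      · obtain ⟨k, hk⟩ := (h3 v hv).1
        exact ⟨k, fun _ => hk⟩
    choose f hf using hf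
    refine ⟨f, fun v hv h0 => ?_, fun v hv => (hf v (hne v hv)).1, fun u hu v hv huv he => ?_,
      fun u hu v hv huv he => ?_⟩
    · have hvX : ((v : Fin I.n) : ℕ) ∉ X := fun h => h0 (hX _ h).2.1
      have hov : overlay col γ' X (v : Fin I.n) = col (v : Fin I.n) := by simp [overlay, hvX]
      rw [← (hf v (hne v hv)).2, h1 _ (by rwa [hov]), hov]
    · refine (h3 u (hne u hu)).2 v huv ?_
      rw [(hf u (hne u hu)).2, (hf v (hne v hv)).2, he]
    · refine (h3 u (hne u hu)).2 v huv ?_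
      have hvN : v ∈ N := by
        simp only [hNdef, Finset.mem_filter, Finset.mem_univ, true_and]
        exact ⟨hv, u, hu, huv.symm⟩
      -- All of `N` carries the colours of γ: by the overlay where `col` was uncoloured, and by the
      -- compatibility `hγ` elsewhere.
      have hov : overlay col γ' X v = γ v + 1 := by
        by_cases h0 : col v = 0
        · have : (v : ℕ) ∈ X := Finset.mem_image.2 ⟨v, Finset.mem_filter.2 ⟨hvN, h0⟩, rfl⟩
          simp [overlay, this, hγ']
        · have : (v : ℕ) ∉ X := fun h => h0 (hX _ h).2.1
          simp [overlay, this, hγ v hv h0]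
      rw [h1 v (by omega), hov, (hf u (hne u hu)).2, he]
  choose f hf1 hf2 hf3 hf4 using key
  -- Components are coloured independently and glued along γ: an edge outside the hub stays inside
  -- one component.
  let φ : Fin I.n → Fin q := fun v =>
    if h : v ∈ I.Q then γ v else f (SimpleGraph.connectedComponentMk _ ⟨v, by simpa using h⟩) v
  have hφQ : ∀ v ∈ I.Q, φ v = γ v := fun v hv => by simp [φ, hv]
  have hφ : ∀ v (h : v ∉ I.Q), φ v =
      f ((I.G.induce ((I.Q : Set (Fin I.n))ᶜ)).connectedComponentMk ⟨v, by simpa using h⟩) v :=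
    fun v hv => by simp [φ, hv]
  refine ⟨SimpleGraph.Coloring.mk φ ?_, ?_, ?_, hφQ⟩
  · intro u v huv
    by_cases hu : u ∈ I.Q <;> by_cases hv : v ∈ I.Q
    · rw [hφQ u hu, hφQ v hv]; exact hγG u hu v hv huv
    · rw [hφQ u hu, hφ v hv]
      exact (hf4 _ ⟨v, by simpa using hv⟩ rfl u hu huv.symm).symm
    · rw [hφ u hu, hφQ v hv]
      exact hf4 _ ⟨u, by simpa using hu⟩ rfl v hv huv
    · have hC : (I.G.induce ((I.Q : Set (Fin I.n))ᶜ)).connectedComponentMk ⟨u, by simpa using hu⟩ =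
          (I.G.induce ((I.Q : Set (Fin I.n))ᶜ)).connectedComponentMk ⟨v, by simpa using hv⟩ :=
        SimpleGraph.ConnectedComponent.sound (SimpleGraph.Adj.reachable (by simpa using huv))
      rw [hφ u hu, hφ v hv, hC]
      exact hf3 _ ⟨u, by simpa using hu⟩ hC ⟨v, by simpa using hv⟩ rfl huv
  · intro v
    change φ v ∈ I.L v
    by_cases hv : v ∈ I.Q
    · rw [hφQ v hv]; exact hγL v hv
    · rw [hφ v hv]; exact hf2 _ ⟨v, by simpa using hv⟩ rfl
  · intro v h0
    change col v = (φ v : ℕ) + 1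
    by_cases hv : v ∈ I.Q
    · rw [hφQ v hv]; exact hγ v hv h0
    · rw [hφ v hv]; exact hf1 _ ⟨v, by simpa using hv⟩ rfl h0

/-- Once the whole hub is coloured, a winning position is extendable. -/
lemma hasExt_of_ext {σ δ : ℕ} (hq : 0 < q) (hI : IsHub I.G σ δ I.Q) {col : ℕ →
    ℕ} (hlive : I.Ext σ col)
    (hQ : ∀ v < I.n, 1 ≤ I.hub v → col v ≠ 0) : I.HasExt col := by
  have hQ' : ∀ v ∈ I.Q, col v ≠ 0 := fun v hv => hQ v v.2 ((one_le_hub v).2 hv)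
  have hcons := hlive.cons
  have hγ : ∀ v : Fin I.n, ∃ k : Fin q, v ∈ I.Q → k ∈ I.L v ∧ col v = (k : ℕ) + 1 := by
    intro v
    by_cases hv : v ∈ I.Q
    · obtain ⟨k, hk⟩ := (hcons v (hQ' v hv)).1
      exact ⟨k, fun _ => hk⟩
    · exact ⟨⟨0, hq⟩, fun h => absurd h hv⟩
  choose γ hγ using hγ
  -- With no uncoloured hub vertex left, every positive level is vacuously live.
  obtain ⟨φ, h1, h2, -⟩ := exists_listColoring_of_live hI (col := col) (fun k _ => by
    cases k with
    | zero => exact hlive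
    | succ k =>
      intro v hv
      obtain ⟨a, b, c, -⟩ := fails_full_iff.1 hv
      exact hQ v a c b) γ (fun v hv _ => (hγ v hv).2) (fun v hv => (hγ v hv).1)
    (fun u hu v hv huv he => (hcons u (hQ' u hu)).2 v huv (by
      rw [(hγ u hu).2, (hγ v hv).2, he]))
  exact ⟨φ, h1, h2⟩

/-- If everything within reach of `δ` steps is winning, the uncoloured part of the hub carries
no constraint but its edges, so that by symmetry any of its vertices may get any colour. -/
lemma HasExt.update_of_live {σ δ : ℕ} (hδ : 1 ≤ δ) (hI : IsHub I.G σ δ I.Q) {col : ℕ → ℕ}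
    (hlive : ∀ k ≤ δ, I.Live σ k col) (h : I.HasExt col) {v : ℕ} (hv : v < I.n) (hv0 : col v = 0)
    (hvQ : 1 ≤ I.hub v) {c : ℕ} (hc : c < q) : I.HasExt (Function.update col v (c + 1)) := by
  classical
  obtain ⟨φ, hL, hφ⟩ := h
  have hcons : I.Cons col := (show I.Ext σ col from hlive 0 (Nat.zero_le _)).cons
  -- Level 1: an uncoloured hub vertex may consistently receive any colour `k`, so `k` is in its
  -- list and no neighbour already has it.
  have hfree : ∀ u ∈ I.Q, col u = 0 → ∀ k : Fin q, k ∈ I.L u ∧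
      ∀ w, I.G.Adj u w → col w ≠ (k : ℕ) + 1 := by
    intro u hu hu0 k
    have h1 := hlive 1 hδ u
    rw [fails_full_iff] at h1
    push Not at h1
    have h2 := (show I.Ext σ _ from h1 u.2 hu0 ((one_le_hub u).2 hu) k k.2).cons u (by simp)
    simp only [Function.update_self] at h2
    obtain ⟨⟨k', hk', he⟩, h3⟩ := h2
    refine ⟨by rwa [Fin.ext (show (k : ℕ) = k' by omega)], fun w hw he => h3 w hw ?_⟩
    rw [Function.update_of_ne (fun h => hw.ne (Fin.ext h.symm)), he]
  -- A coloured neighbour would have some colour `k`, which `hfree` forbids.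
  have hsep : ∀ u ∈ I.Q, col u = 0 → ∀ w, I.G.Adj u w → col w = 0 := by
    intro u hu hu0 w hw
    by_contra hw0
    obtain ⟨k, -, hk⟩ := (hcons w hw0).1
    exact (hfree u hu hu0 k).2 w hw hk
  -- Exchanging two colours on the uncoloured hub vertices only keeps γ proper by `hsep` and within
  -- the lists by `hfree`. The colours off the hub are then chosen anew.
  let π : Equiv.Perm (Fin q) := Equiv.swap (φ ⟨v, hv⟩) ⟨c, hc⟩
  let γ : Fin I.n → Fin q := fun u => if col u = 0 then π (φ u) else φ u
  obtain ⟨ψ, h1, h2, h3⟩ := exists_listColoring_of_live hI hlive γ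
    (fun u _ h0 => by simp only [γ, h0, if_false]; exact hφ u h0)
    (fun u hu => by
      by_cases h0 : col u = 0
      · exact (hfree u hu h0 _).1
      · simp only [γ, h0, if_false]; exact hL u)
    (fun u hu w hw huw he => by
      by_cases h0 : col u = 0
      · have h0' := hsep u hu h0 w huw
        simp only [γ, h0, h0', if_true] at he
        exact φ.valid huw (π.injective he)
      · by_cases h0' : col w = 0
        · exact h0 (hsep w hw h0' u huw.symm)
        · simp only [γ, h0, h0', if_false] at he
          exact φ.valid huw he)
  have hψ : ψ ⟨v, hv⟩ = ⟨c, hc⟩ := by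
    rw [h3 _ ((one_le_hub ⟨v, hv⟩).1 hvQ)]
    simp [γ, hv0, π]
  refine ⟨ψ, h1, ?_⟩
  have := h2.update ⟨v, hv⟩
  rwa [hψ] at this

end Instance
-- Absorbing constants into powers of n + 2.
section Time

lemma lt_pow_of_le (n : ℕ) {k a : ℕ} (h : k ≤ a) : k < (n + 2) ^ a :=
  lt_of_le_of_lt h (lt_of_lt_of_le Nat.lt_two_pow_self (Nat.pow_le_pow_left (by omega) a))

/-- As `n + 2 ≥ 2`, a constant `k` is below `(n + 2) ^ k`. Hence every time bound can be kept as a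
pure power, which also serves as a lower bound for the word size. -/
lemma mul_pow_le (n k a : ℕ) : k * (n + 2) ^ a ≤ (n + 2) ^ (a + k) := by
  rw [pow_add, mul_comm]
  exact Nat.mul_le_mul_left _ (lt_pow_of_le n le_rfl).le

lemma pow_le_pow_base (n : ℕ) {a b : ℕ} (h : a ≤ b) : (n + 2) ^ a ≤ (n + 2) ^ b :=
  Nat.pow_le_pow_right (by omega) h

lemma add_const_le (n a k : ℕ) : (n + 2) ^ a + k ≤ (n + 2) ^ (a + (k + 1)) := by
  refine le_trans ?_ (mul_pow_le n (k + 1) a)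
  have : 1 ≤ (n + 2) ^ a := Nat.one_le_pow _ _ (by omega)
  nlinarith

lemma loop_const_le (n a k c d : ℕ) :
    k * ((n + 2) ^ a + c) + d ≤ (n + 2) ^ (a + (k * (c + 1) + d)) := by
  refine le_trans ?_ (mul_pow_le n _ a)
  have : 1 ≤ (n + 2) ^ a := Nat.one_le_pow _ _ (by omega)
  have h1 : (n + 2) ^ a + c ≤ (n + 2) ^ a * (c + 1) := by nlinarith
  have h2 : d ≤ d * (n + 2) ^ a := Nat.le_mul_of_pos_right _ (by omega)
  calc _ ≤ k * ((n + 2) ^ a * (c + 1)) + d * (n + 2) ^ a := by gcongr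
    _ = _ := by ring

lemma loop_le (n a c d : ℕ) : n * ((n + 2) ^ a + c) + d ≤ (n + 2) ^ (a + 1 + (c + 1 + d)) := by
  refine le_trans ?_ (mul_pow_le n _ _)
  have : 1 ≤ (n + 2) ^ a := Nat.one_le_pow _ _ (by omega)
  have h1 : (n + 2) ^ a + c ≤ (n + 2) ^ a * (c + 1) := by nlinarith
  have h2 : d ≤ d * (n + 2) ^ (a + 1) := Nat.le_mul_of_pos_right _ (by positivity)
  calc _ ≤ (n + 2) * ((n + 2) ^ a * (c + 1)) + d * (n + 2) ^ (a + 1) := by gcongr; omega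
    _ = _ := by ring

lemma ite_le_one (c : Prop) [Decidable c] : (if c then 1 else 0) ≤ 1 := by
  split_ifs <;> omega

end Time

/-! ### Contracts for subroutines that test the current partial colouring. -/

/-- The registers and arrays that describe the instance are intact, and array `3` holds a partial
colouring. -/
structure Valid {q : ℕ} (I : Instance q) (s : State) : Prop where
  reg0 : s.reg 0 = I.n
  arr0 : s.arr 0 = I.input.arr 0
  arr1 : s.arr 1 = I.input.arr 1
  arr2 : s.arr 2 = I.hub
  col_le : ∀ v < I.n, s.arr 3 v ≤ q

/-- `s'` differs from `s` only in the registers `1`, `6` and `16, …, m - 1`. -/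
def Keeps (m : ℕ) (s s' : State) : Prop :=
  s'.arr = s.arr ∧ ∀ r, r ≠ 1 → r ≠ 6 → r < 16 ∨ m ≤ r → s'.reg r = s.reg r

lemma Keeps.refl (m : ℕ) (s : State) : Keeps m s s := ⟨rfl, fun _ _ _ _ => rfl⟩

lemma Keeps.trans {m : ℕ} {s s' s'' : State} (h : Keeps m s s') (h' : Keeps m s' s'') :
    Keeps m s s'' :=
  ⟨h'.1.trans h.1, fun r a b c => (h'.2 r a b c).trans (h.2 r a b c)⟩

lemma Keeps.mono {m m' : ℕ} {s s' : State} (h : Keeps m s s') (hm : m ≤ m') : Keeps m' s s' :=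
  ⟨h.1, fun r a b c => h.2 r a b (by omega)⟩

lemma Keeps.setReg {m r x : ℕ} {s s' : State} (h : Keeps m s s')
    (hr : r = 1 ∨ r = 6 ∨ 16 ≤ r ∧ r < m) : Keeps m s (s'.setReg r x) :=
  ⟨h.1, fun r' a b c => by
    have : r' ≠ r := by omega
    simp [State.setReg, Function.update_of_ne this, h.2 r' a b c]⟩

lemma Valid.keeps {q m : ℕ} {I : Instance q} {s s' : State} (h : Valid I s) (hk : Keeps m s s') :
    Valid I s' := by
  obtain ⟨h0, h1, h2, h3, h4⟩ := h
  constructor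
  · rw [hk.2 0 (by omega) (by omega) (by omega), h0]
  all_goals rw [hk.1]; assumption

lemma Valid.setCol {q : ℕ} {I : Instance q} {s : State} (h : Valid I s) (v : ℕ) {x : ℕ}
    (hx : x ≤ q) : Valid I (s.setArr 3 v x) := by
  refine ⟨h.reg0, ?_, ?_, ?_, fun u hu => ?_⟩
  · simpa [State.setArr] using h.arr0
  · simpa [State.setArr] using h.arr1
  · simpa [State.setArr] using h.arr2
  · simp only [State.setArr, Function.update_self, Function.update_apply]
    split_ifs
    · exact hx
    · exact h.col_le u hu

/-- `P` decides the property `p` of the partial colouring, with the answer in register `1`, in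
time `(n + 2) ^ a`; it uses the registers below `4 * ℓ + 20` as scratch memory. -/
def Computes (q a ℓ : ℕ) (P : Program) (p : Instance q → (ℕ → ℕ) → Prop) : Prop :=
  ∀ (I : Instance q) (W : ℕ) (s : State), (I.n + 2) ^ a ≤ W → Valid I s →
    Runs W ((I.n + 2) ^ a) P s fun s' => Keeps (4 * ℓ + 20) s s' ∧
      (s'.reg 1 = 1 ∧ p I (s.arr 3) ∨ s'.reg 1 = 0 ∧ ¬ p I (s.arr 3))

/-- `P` searches a vertex with property `f`. It reports `1` in register `1` if there is none, and
otherwise puts `v + 1` into register `6` for such a vertex `v`. -/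
def Searches (q a ℓ : ℕ) (P : Program) (f : Instance q → (ℕ → ℕ) → ℕ → Prop) : Prop :=
  ∀ (I : Instance q) (W : ℕ) (s : State), (I.n + 2) ^ a ≤ W → Valid I s →
    Runs W ((I.n + 2) ^ a) P s fun s' => Keeps (4 * ℓ + 20) s s' ∧
      (s'.reg 1 = 1 ∧ (∀ v, ¬ f I (s.arr 3) v) ∨
        s'.reg 1 = 0 ∧ ∃ v, f I (s.arr 3) v ∧ s'.reg 6 = v + 1)

lemma Searches.computes {q a ℓ : ℕ} {P : Program} {f : Instance q → (ℕ → ℕ) → ℕ → Prop}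
    (h : Searches q a ℓ P f) : Computes q a ℓ P fun I col => ∀ v, ¬ f I col v := by
  intro I W s hW hs
  refine (h I W s hW hs).mono le_rfl fun s' ⟨hk, h'⟩ => ⟨hk, ?_⟩
  rcases h' with h' | ⟨h1, v, hv, -⟩
  · exact .inl h'
  · exact .inr ⟨h1, fun h => h v hv⟩

/-! ### Generic search for a vertex by counting its good colours. -/

/-- Count in register `4 * ℓ + 22` the colours of the vertex in register `4 * ℓ + 20` for which `P`
succeeds. -/
def countProg (q ℓ : ℕ) (P : Program) : Program :=
  .seq (.assign (4 * ℓ + 22) (.const 0))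
    (forLoop (4 * ℓ + 21) (.const q)
      (.seq (.store 3 (.reg (4 * ℓ + 20)) (.add (.reg (4 * ℓ + 21)) (.const 1)))
        (.seq P (.seq (.store 3 (.reg (4 * ℓ + 20)) (.const 0))
          (.assign (4 * ℓ + 22) (.add (.reg (4 * ℓ + 22)) (.reg 1)))))))

/-- Check the vertex in register `4 * ℓ + 20` and report it in register `4 * ℓ + 23`. -/
def searchBody (q ℓ thr thrQ : ℕ) (P : Program) : Program :=
  .branch (.mul (.eq (.get 3 (.reg (4 * ℓ + 20))) (.const 0))
      (.eq (.lt (.get 2 (.reg (4 * ℓ + 20))) (.const thrQ)) (.const 0)))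
    (.seq (countProg q ℓ P)
      (.branch (.lt (.reg (4 * ℓ + 22)) (.const thr))
        (.assign (4 * ℓ + 23) (.add (.reg (4 * ℓ + 20)) (.const 1))) .nop))
    .nop

/-- Search a vertex that fails in the sense of `Instance.Fails`, where `P` decides `p`. -/
def searchProg (q ℓ thr thrQ : ℕ) (P : Program) : Program :=
  .seq (.assign (4 * ℓ + 23) (.const 0)) (.seq
    (forLoop (4 * ℓ + 20) (.reg 0)
      (searchBody q ℓ thr thrQ P))
    (.seq (.assign 6 (.reg (4 * ℓ + 23))) (.assign 1 (.eq (.reg (4 * ℓ + 23)) (.const 0)))))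

-- The trial colours are written into array `3` itself. Writing `0` afterwards restores it, because
-- `v` was uncoloured by `h0`. The counters lie beyond the scratch registers of `P`, so they survive
-- its execution.
open Classical in
lemma Computes.count {q a ℓ : ℕ} {P : Program} {p : Instance q → (ℕ → ℕ) → Prop}
    (hP : Computes q a ℓ P p) (I : Instance q) {W : ℕ} {s : State} (hW : (I.n + 2) ^ a ≤ W)
    (hqW : q + 1 < W) (hs : Valid I s) {v : ℕ} (hv : s.reg (4 * ℓ + 20) = v) (h0 : s.arr 3 v = 0) :
    Runs W (q * ((I.n + 2) ^ a + 20) + 8) (countProg q ℓ P) s fun s' =>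
      s'.arr = s.arr ∧ (∀ r, r ≠ 1 → r ≠ 6 → r < 16 ∨ r = 4 * ℓ + 20 ∨ 4 * ℓ + 23 ≤ r →
        s'.reg r = s.reg r) ∧
      s'.reg (4 * ℓ + 22) =
        ((Finset.range q).filter fun c => p I (Function.update (s.arr 3) v (c + 1))).card := by
  let cnt : ℕ → ℕ := fun j =>
    ((Finset.range j).filter fun c => p I (Function.update (s.arr 3) v (c + 1))).card
  have hcnt : ∀ j, cnt (j + 1) = cnt j + if p I (Function.update (s.arr 3) v (j + 1))
    then 1 else 0 := by
    intro j
    simp only [cnt, Finset.range_add_one, Finset.filter_insert]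
    split_ifs <;> simp
  have hcntle : ∀ j, cnt j ≤ j := fun j =>
    (Finset.card_filter_le _ _).trans_eq (Finset.card_range j)
  let J : ℕ → State → Prop := fun j s' => s'.arr = s.arr ∧
    (∀ r, r ≠ 1 → r ≠ 6 → r < 16 ∨ r = 4 * ℓ + 20 ∨ 4 * ℓ + 23 ≤ r → s'.reg r = s.reg r) ∧
    s'.reg (4 * ℓ + 21) = j ∧ s'.reg (4 * ℓ + 22) = cnt j
  have hloop : ∀ s₁, s₁.arr = s.arr ∧
      (∀ r, r ≠ 1 → r ≠ 6 → r < 16 ∨ r = 4 * ℓ + 20 ∨ 4 * ℓ + 23 ≤ r → s₁.reg r = s.reg r) ∧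
      s₁.reg (4 * ℓ + 22) = 0 → Runs W (q * (((I.n + 2) ^ a + 12) + 1 + 7) + 1 + 5)
        (forLoop (4 * ℓ + 21) (.const q)
      (.seq (.store 3 (.reg (4 * ℓ + 20)) (.add (.reg (4 * ℓ + 21)) (.const 1)))
        (.seq P (.seq (.store 3 (.reg (4 * ℓ + 20)) (.const 0))
          (.assign (4 * ℓ + 22) (.add (.reg (4 * ℓ + 22)) (.reg 1))))))) s₁ (J q) := by
    rintro s₁ ⟨ha, hf, hc⟩
    refine Runs.forLoop J (by omega) ?_ ?_ (fun i s' h => h.2.2.1) ?_ (fun _ h => h)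
    · refine ⟨by simpa [State.setReg] using ha, fun r h1 h6 hr => ?_, by simp [State.setReg], ?_⟩
      · have : r ≠ 4 * ℓ + 21 := by omega
        simp [State.setReg, Function.update_of_ne this, hf r h1 h6 hr]
      · simp [State.setReg, hc, cnt]
    · intro i s' _
      exact ⟨by simp only [Expr.Fits]; omega, rfl⟩
    · rintro i hi s₂ ⟨ha, hf, hc, hn⟩
      have hv₂ : s₂.reg (4 * ℓ + 20) = v := by rw [hf _ (by omega) (by omega) (by omega), hv]
      have hs₂ : Valid I s₂ := by
        obtain ⟨g0, g1, g2, g3, g4⟩ := hs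
        exact ⟨by rw [hf 0 (by omega) (by omega) (by omega), g0], by rwa [ha], by rwa [ha],
          by rwa [ha], by rwa [ha]⟩
      have hT : (I.n + 2) ^ a + 12 = 5 + ((I.n + 2) ^ a + (3 + 4)) := by omega
      rw [hT]
      refine Runs.seq (T₁ := 5) (mid := fun s₃ => s₃ = s₂.setArr 3 v (i + 1))
        (Runs.store trivial ⟨trivial, by simp only [Expr.Fits]; omega, by
          simp only [Expr.eval]; omega⟩ (by simp [Expr.eval, hv₂, hc])) ?_
      rintro s₃ rfl
      refine Runs.seq (hP I W _ hW (hs₂.setCol v (by omega))) ?_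
      rintro s₄ ⟨⟨hka, hkr⟩, hres⟩
      have e20 : s₄.reg (4 * ℓ + 20) = v := by
        rw [hkr _ (by omega) (by omega) (by omega)]; exact hv₂
      have e21 : s₄.reg (4 * ℓ + 21) = i := by
        rw [hkr _ (by omega) (by omega) (by omega)]; exact hc
      have e22 : s₄.reg (4 * ℓ + 22) = cnt i := by
        rw [hkr _ (by omega) (by omega) (by omega)]; exact hn
      have hcol : (s₂.setArr 3 v (i + 1)).arr 3 = Function.update (s.arr 3) v (i + 1) := by
        simp [State.setArr, ha]
      have e1 : s₄.reg 1 = if p I (Function.update (s.arr 3) v (i + 1)) then 1 else 0 := by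
        rw [hcol] at hres
        split_ifs with hp
        · exact (hres.resolve_right fun h => h.2 hp).1
        · exact (hres.resolve_left fun h => hp h.2).1
      have harr : (s₄.setArr 3 v 0).arr = s.arr := by
        simp only [State.setArr, hka, ha, Function.update_self, Function.update_idem]
        rw [← h0, Function.update_eq_self, Function.update_eq_self]
      refine Runs.seq (T₁ := 3) (mid := fun s₅ => s₅ = s₄.setArr 3 v 0)
        (Runs.store trivial (by simp only [Expr.Fits]; omega) (by simp [Expr.eval, e20])) ?_
      rintro s₅ rfl
      have hci := hcntle i
      have hci1 := hcntle (i + 1)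
      rw [hcnt] at hci1
      refine Runs.assign ⟨trivial, trivial, ?_⟩ ?_
      · simp only [Expr.eval, State.setArr, e22, e1]; omega
      · refine ⟨?_, ?_, ?_, ?_, ?_⟩
        · simp [State.setReg, State.setArr, e21]
        · simpa [State.setReg] using harr
        · intro r h1 h6 hr
          have n1 : r ≠ 4 * ℓ + 21 := by omega
          have n2 : r ≠ 4 * ℓ + 22 := by omega
          simp only [State.setReg, Function.update_of_ne n1, Function.update_of_ne n2]
          by_cases hr' : r = 4 * ℓ + 20
          · rw [hr']; simp [State.setArr, e20, hv]
          · change s₄.reg r = _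
            rw [hkr r h1 h6 (by omega)]
            exact hf r h1 h6 hr
        · simp [State.setReg]
        · simp [State.setReg, Expr.eval, State.setArr, e22, e1, hcnt]
  refine (Runs.seq (T₁ := 2) (Runs.assign (by simp only [Expr.Fits]; omega) ?_) hloop).mono
    (le_of_eq (by ring)) ?_
  · refine ⟨rfl, fun r h1 h6 hr => ?_, by simp [State.setReg, Expr.eval]⟩
    have : r ≠ 4 * ℓ + 22 := by omega
    simp [State.setReg, Function.update_of_ne this]
  · rintro s' ⟨ha, hf, -, hn⟩
    exact ⟨ha, hf, hn⟩

lemma Computes.search {q a ℓ : ℕ} {P : Program} {p : Instance q → (ℕ → ℕ) → Prop}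
    (hP : Computes q a ℓ P p) (thr thrQ : ℕ) :
    ∃ a', Searches q a' (ℓ + 1) (searchProg q ℓ thr thrQ P)
      fun I => I.Fails thr thrQ (p I) := by
  set a₁ := a + (q * (20 + 1) + 8) with ha₁
  -- `a₁ + 1 + 61` pays for the loop over the vertices; the summands `thr`, `thrQ` and `q` make
  -- these constants fit into a word.
  refine ⟨a₁ + 1 + (40 + 1 + 20) + thr + thrQ + q, fun I W s hW hs => ?_⟩
  have hW1 : (I.n + 2) ^ a ≤ W := (pow_le_pow_base I.n (by omega)).trans hW
  have hqW : q + 1 < W := (lt_pow_of_le I.n (by omega)).trans_le hW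
  have htW : thr < W := (lt_pow_of_le I.n (by omega)).trans_le hW
  have htW' : thrQ < W := (lt_pow_of_le I.n (by omega)).trans_le hW
  have hnW : I.n + 2 < W := by
    have : I.n + 2 < (I.n + 2) ^ 2 := by nlinarith
    exact (this.trans_le (pow_le_pow_base I.n (by omega))).trans_le hW
  have h1W : 2 < W := by omega
  set f := I.Fails thr thrQ (p I) (s.arr 3) with hf
  -- Register `4 * ℓ + 23` is shifted by one, so that `0` can mean that no failing vertex has been
  -- met.
  let J : ℕ → State → Prop := fun i s' => Keeps (4 * (ℓ + 1) + 20) s s' ∧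
    s'.reg (4 * ℓ + 20) = i ∧
    (s'.reg (4 * ℓ + 23) = 0 ∧ (∀ v < i, ¬ f v) ∨ ∃ v, f v ∧ s'.reg (4 * ℓ + 23) = v + 1)
  have hTq : q * ((I.n + 2) ^ a + 20) + 8 ≤ (I.n + 2) ^ a₁ := loop_const_le _ _ _ _ _
  have hbody : ∀ i < I.n, ∀ s', J i s' → Runs W ((I.n + 2) ^ a₁ + 21)
      (searchBody q ℓ thr thrQ P) s' (fun s'' => s''.reg (4 * ℓ + 20) = i ∧ J (i + 1)
        (s''.setReg (4 * ℓ + 20) (i + 1))) := by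
    rintro i hi s₁ ⟨hk, hvi, hacc⟩
    have hs₁ := hs.keeps hk
    have hT : (I.n + 2) ^ a₁ + 21 = 11 + 1 + ((I.n + 2) ^ a₁ + 9) := by omega
    rw [hT]
    refine Runs.branch ?_ ?_ ?_
    · simp only [Expr.Fits, Expr.eval, true_and]
      refine ⟨by omega, ⟨by omega, by omega⟩,
        lt_of_le_of_lt (Nat.mul_le_mul (ite_le_one _) (ite_le_one _)) (by omega)⟩
    · intro hne
      have h0 : s₁.arr 3 i = 0 := by
        by_contra h
        simp [Expr.eval, hvi, h] at hne
      have hQ : thrQ ≤ I.hub i := by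
        by_contra h
        simp only [not_le] at h
        simp [Expr.eval, hvi, hs₁.arr2, h] at hne
      refine Runs.seq ((hP.count I hW1 hqW hs₁ hvi h0).weaken hTq) ?_
      rintro s₂ ⟨ha₂, hf₂, hc₂⟩
      have hk₂ : Keeps (4 * (ℓ + 1) + 20) s s₂ :=
        ⟨ha₂.trans hk.1, fun r h1 h6 hr => (hf₂ r h1 h6 (by omega)).trans (hk.2 r h1 h6 hr)⟩
      have e20 : s₂.reg (4 * ℓ + 20) = i := by rw [hf₂ _ (by omega) (by omega) (by omega), hvi]
      have e23 : s₂.reg (4 * ℓ + 23) = s₁.reg (4 * ℓ + 23) := hf₂ _ (by omega) (by omega) (by omega)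
      rw [hk.1] at hc₂ h0
      refine Runs.branch (T := 5) ⟨trivial, htW⟩ ?_ ?_
      · intro hne
        have hlt : s₂.reg (4 * ℓ + 22) < thr := by
          by_contra h
          simp [Expr.eval, h] at hne
        refine Runs.weaken (Runs.assign ⟨trivial, by simp only [Expr.Fits]; omega,
          by simp only [Expr.eval]; omega⟩ ?_) (by simp [Expr.cost])
        refine ⟨by simp [State.setReg, e20], (hk₂.setReg (by omega)).setReg (by omega),
          by simp [State.setReg], .inr ⟨i, ⟨hi, h0, hQ, ?_⟩, by simp [State.setReg, Expr.eval,
            e20]⟩⟩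
        rwa [hc₂] at hlt
      · intro he
        have hlt : ¬ s₂.reg (4 * ℓ + 22) < thr := by
          intro h
          simp [Expr.eval, h] at he
        refine (Runs.nop ?_).weaken (by omega)
        refine ⟨e20, hk₂.setReg (by omega), by simp [State.setReg], ?_⟩
        simp only [State.setReg]
        rw [Function.update_of_ne (by omega), e23]
        refine hacc.imp_left fun h => ⟨h.1, fun v hv => ?_⟩
        rcases Nat.lt_succ_iff_lt_or_eq.1 hv with hv | rfl
        · exact h.2 v hv
        · rintro ⟨-, -, -, h⟩
          rw [hc₂] at hlt
          exact hlt h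
    · intro he
      refine (Runs.nop ?_).weaken (by omega)
      refine ⟨hvi, hk.setReg (by omega), by simp [State.setReg], ?_⟩
      simp only [State.setReg]
      rw [Function.update_of_ne (by omega)]
      refine hacc.imp_left fun h => ⟨h.1, fun v hv => ?_⟩
      rcases Nat.lt_succ_iff_lt_or_eq.1 hv with hv | rfl
      · exact h.2 v hv
      · rintro ⟨-, h0, hQ, -⟩
        rw [← hk.1] at h0
        simp [Expr.eval, hvi, h0, hs₁.arr2, not_lt.2 hQ] at he
  have hloop : ∀ s₁, Keeps (4 * (ℓ + 1) + 20) s s₁ ∧ s₁.reg (4 * ℓ + 23) = 0 →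
      Runs W (I.n * (((I.n + 2) ^ a₁ + 21) + 1 + 7) + 1 + 5)
        (forLoop (4 * ℓ + 20) (.reg 0) (searchBody q ℓ thr thrQ P)) s₁ (J I.n) := by
    rintro s₁ ⟨hk, h0⟩
    refine Runs.forLoop J (by omega) ?_ ?_ (fun i s' h => h.2.1) hbody (fun _ h => h)
    · exact ⟨hk.setReg (by omega), by simp [State.setReg], .inl ⟨by simp [State.setReg, h0],
        by simp⟩⟩
    · exact fun i s' h => ⟨trivial, (hs.keeps h.1).reg0⟩
  have hfin : ∀ s₁, J I.n s₁ → Runs W (2 + 4)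
      (.seq (.assign 6 (.reg (4 * ℓ + 23))) (.assign 1 (.eq (.reg (4 * ℓ + 23)) (.const 0)))) s₁
      fun s' => Keeps (4 * (ℓ + 1) + 20) s s' ∧
      (s'.reg 1 = 1 ∧ (∀ v, ¬ f v) ∨ s'.reg 1 = 0 ∧ ∃ v, f v ∧ s'.reg 6 = v + 1) := by
    rintro s₁ ⟨hk, -, hacc⟩
    refine Runs.seq (Runs.assign trivial (rfl : _ = _)) ?_
    rintro s₂ rfl
    refine Runs.assign ⟨trivial, by simp only [Expr.Fits]; omega⟩
      ⟨(hk.setReg (by omega)).setReg (by omega), ?_⟩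
    rcases hacc with ⟨h0, hno⟩ | ⟨v, hv, hacc⟩
    · refine .inl ⟨by simp [State.setReg, Expr.eval, h0], fun v hv => hno v hv.1 hv⟩
    · exact .inr ⟨by simp [State.setReg, Expr.eval, hacc], v, hv, by simp [State.setReg, Expr.eval,
        hacc]⟩
  refine Runs.weaken (Runs.seq (T₁ := 2) (Runs.assign (by simp only [Expr.Fits]; omega)
    ⟨(Keeps.refl _ s).setReg (by omega), by simp [State.setReg, Expr.eval]⟩)
    fun s₁ h => Runs.seq (hloop s₁ h) hfin) ?_
  have h1 := loop_le I.n a₁ 29 14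
  have h2 := pow_le_pow_base I.n (show a₁ + 1 + (29 + 1 + 14) ≤ a₁ + 1 + (40 + 1 + 20)
    + thr + thrQ + q by omega)
  have h3 : I.n * ((I.n + 2) ^ a₁ + 21 + 1 + 7) + 14 = I.n * ((I.n + 2) ^ a₁ + 29) + 14 := by ring
  omega

/-! ### Deciding consistency of a partial colouring. -/

/-- Nonzero if the pair `(i / n, i % n)` witnesses that array `3` is not consistent, where `i` is
the content of register `16`. -/
def conflictExpr (q : ℕ) : Expr :=
  .mul (.lt (.const 0) (.get 3 (.div (.reg 16) (.reg 0))))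
    (.add (.mul (.get 0 (.reg 16))
        (.eq (.get 3 (.div (.reg 16) (.reg 0))) (.get 3 (.mod (.reg 16) (.reg 0)))))
      (.sub (.const 1) (.get 1 (.add (.mul (.div (.reg 16) (.reg 0)) (.const q))
        (.sub (.get 3 (.div (.reg 16) (.reg 0))) (.const 1))))))

/-- Decide the consistency of array `3`. -/
def consProg (q : ℕ) : Program :=
  .seq (.assign 17 (.const 1)) (.seq
    (forLoop 16 (.mul (.reg 0) (.reg 0)) (.branch (conflictExpr q) (.assign 17 (.const 0)) .nop))
    (.assign 1 (.reg 17)))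

namespace Instance

variable {q : ℕ} {I : Instance q}

-- Division with remainder by `n` recovers `u` and `v` from the cell index, so the existential in
-- `inputState` has no other witness.
open Classical in
lemma input_arr_zero (u v : Fin I.n) :
    I.input.arr 0 (u * I.n + v) = if I.G.Adj u v then 1 else 0 := by
  unfold input inputState
  simp only [if_true]
  congr 1
  simp only [eq_iff_iff]
  constructor
  · rintro ⟨u', v', h, hA⟩
    have hpos : 0 < I.n := u.pos
    have hu : (u : ℕ) = u' := by
      have := congrArg (· / I.n) h
      simpa [Nat.mul_add_div hpos, mul_comm _ I.n, Nat.div_eq_of_lt] using this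
    have hv : (v : ℕ) = v' := by rw [hu] at h; omega
    rwa [Fin.ext hu, Fin.ext hv]
  · exact fun h => ⟨u, v, rfl, h⟩

open Classical in
lemma input_arr_one (v : Fin I.n) (k : Fin q) :
    I.input.arr 1 (v * q + k) = if k ∈ I.L v then 1 else 0 := by
  unfold input inputState
  simp only [one_ne_zero, if_false, if_true]
  congr 1
  simp only [eq_iff_iff]
  constructor
  · rintro ⟨u, k', h, hA⟩
    have hpos : 0 < q := k.pos
    have hu : (v : ℕ) = u := by
      have := congrArg (· / q) h
      simpa [Nat.mul_add_div hpos, mul_comm _ q, Nat.div_eq_of_lt] using this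
    have hv : (k : ℕ) = k' := by rw [hu] at h; omega
    rwa [Fin.ext hu, Fin.ext hv]
  · exact fun h => ⟨v, k, rfl, h⟩

lemma input_arr_zero_le (i : ℕ) : I.input.arr 0 i ≤ 1 := by
  unfold input inputState
  simp only [if_true]
  split_ifs <;> omega

end Instance

/-- The expression is [u coloured] · ([uv an edge] · [equal colours] + [colour of u not in its
list]). Truncated subtraction from `1` negates a 0/1 value, and the first factor hides the
meaningless list lookup when `u` is uncoloured. -/
lemma conflictExpr_eval_eq_zero {q : ℕ} {I : Instance q} {s : State} (hs : Valid I s)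
    (u v : Fin I.n) (hi : s.reg 16 = u * I.n + v) :
    (conflictExpr q).eval s = 0 ↔ (s.arr 3 u ≠ 0 →
      (∃ k ∈ I.L u, s.arr 3 u = (k : ℕ) + 1) ∧ (I.G.Adj u v → s.arr 3 u ≠ s.arr 3 v)) := by
  classical
  have hpos : 0 < I.n := u.pos
  have hdiv : ((u : ℕ) * I.n + v) / I.n = u := by
    rw [mul_comm, Nat.mul_add_div hpos, Nat.div_eq_of_lt v.2, add_zero]
  have hmod : ((u : ℕ) * I.n + v) % I.n = v := by
    rw [mul_comm, Nat.mul_add_mod, Nat.mod_eq_of_lt v.2]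
  simp only [conflictExpr, Expr.eval, hi, hs.reg0, hdiv, hmod, hs.arr0, hs.arr1,
    Instance.input_arr_zero]
  rcases Nat.eq_zero_or_pos (s.arr 3 u) with h0 | h0
  · simp [h0]
  · have hle := hs.col_le u u.2
    obtain ⟨k, hk⟩ : ∃ k : Fin q, (k : ℕ) = s.arr 3 u - 1 := ⟨⟨s.arr 3 u - 1, by omega⟩, rfl⟩
    have harr := Instance.input_arr_one (I := I) u k
    rw [hk] at harr
    rw [harr]
    have hex : (∃ k ∈ I.L u, s.arr 3 u = (k : ℕ) + 1) ↔ k ∈ I.L u := by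
      constructor
      · rintro ⟨k', hkL, hke⟩
        rwa [show k = k' from Fin.ext (by omega)]
      · exact fun h => ⟨_, h, by omega⟩
    rw [hex]
    by_cases h1 : k ∈ I.L u <;> by_cases h2 : I.G.Adj u v <;>
      by_cases h3 : s.arr 3 u = s.arr 3 v <;> simp [h1, h2, h3, h0.ne']

lemma consProg_computes (q : ℕ) : ∃ a, Computes q a 0 (consProg q) fun I => I.Cons := by
  refine ⟨q + 100, fun I W s hW hs => ?_⟩
  have hW1 : (q + 1) * (I.n + 2) ^ 1 < W := by
    have h1 := mul_pow_le I.n (q + 1) 1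
    have h2 : (I.n + 2) ^ (1 + (q + 1)) < (I.n + 2) ^ (q + 100) :=
      Nat.pow_lt_pow_right (by omega) (by omega)
    omega
  have hnn : I.n * I.n < W := by
    have : I.n * I.n < (I.n + 2) ^ 2 := by nlinarith
    exact this.trans_le ((pow_le_pow_base I.n (by omega)).trans hW)
  have h2W : 50 < W := (lt_pow_of_le I.n (by omega)).trans_le hW
  have hqW : q < W := (lt_pow_of_le I.n (by omega)).trans_le hW
  let J : ℕ → State → Prop := fun i s' => Keeps 20 s s' ∧ s'.reg 16 = i ∧
    (s'.reg 17 = 1 ∧ (∀ u v : Fin I.n, (u : ℕ) * I.n + v < i → s.arr 3 u ≠ 0 →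
      (∃ k ∈ I.L u, s.arr 3 u = (k : ℕ) + 1) ∧ (I.G.Adj u v → s.arr 3 u ≠ s.arr 3 v)) ∨
     s'.reg 17 = 0 ∧ ¬ I.Cons (s.arr 3))
  have hloop : ∀ s₁, Keeps 20 s s₁ ∧ s₁.reg 17 = 1 →
      Runs W (I.n * I.n * (((conflictExpr q).cost + 1 + 2) + 3 + 7) + 3 + 5)
        (forLoop 16 (.mul (.reg 0) (.reg 0))
          (.branch (conflictExpr q) (.assign 17 (.const 0)) .nop)) s₁ (J (I.n * I.n)) := by
    rintro s₁ ⟨hk, h17⟩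
    refine Runs.forLoop J hnn ?_ ?_ (fun i s' h => h.2.1) ?_ (fun _ h => h)
    · exact ⟨hk.setReg (by omega), by simp [State.setReg], .inl ⟨by simp [State.setReg, h17],
        by simp⟩⟩
    · intro i s' h
      have := (hs.keeps h.1).reg0
      simp only [Expr.Fits, Expr.eval, this, true_and, and_true]
      exact hnn
    · rintro i hi s₂ ⟨hk₂, h16, hacc⟩
      have hs₂ := hs.keeps hk₂
      have hpos : 0 < I.n := Nat.pos_of_ne_zero (by rintro h; simp [h] at hi)
      let u : Fin I.n := ⟨i / I.n, Nat.div_lt_of_lt_mul hi⟩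
      let v : Fin I.n := ⟨i % I.n, Nat.mod_lt _ hpos⟩
      have huv : i = (u : ℕ) * I.n + v := (Nat.div_add_mod' i I.n).symm
      have hev := conflictExpr_eval_eq_zero hs₂ u v (h16.trans huv)
      rw [hk₂.1] at hev
      refine Runs.weaken (T₁ := (conflictExpr q).cost + 1 + 2) (Runs.branch (T := 2) ?_ ?_ ?_)
        le_rfl
      · have hdiv : i / I.n < I.n := u.2
        have hcol := hs₂.col_le _ u.2
        have ha0 : s₂.arr 0 i ≤ 1 := by rw [hs₂.arr0]; exact Instance.input_arr_zero_le i
        have hm : i / I.n * q + (s₂.arr 3 (i / I.n) - 1) < W := by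
          have : i / I.n * q ≤ I.n * q := Nat.mul_le_mul_right _ hdiv.le
          have hcol' : s₂.arr 3 (i / I.n) ≤ q := hcol
          have : (q + 1) * (I.n + 2) ^ 1 = I.n * q + 2 * q + I.n + 2 := by ring
          omega
        simp only [conflictExpr, Expr.Fits, Expr.eval, h16, hs₂.reg0, true_and, and_true]
        have b1 := ite_le_one (s₂.arr 3 (i / I.n) = s₂.arr 3 (i % I.n))
        have b2 := ite_le_one (0 < s₂.arr 3 (i / I.n))
        have b3 := Nat.mul_le_mul ha0 b1
        have b4 : 1 - s₂.arr 1 (i / I.n * q + (s₂.arr 3 (i / I.n) - 1)) ≤ 1 := Nat.sub_le _ _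
        have b5 := Nat.mul_le_mul b2 (Nat.add_le_add b3 b4)
        refine ⟨by omega, ⟨by omega, ⟨by omega, ⟨by omega, by omega⟩, by omega, hm⟩, by omega⟩,
          by omega⟩
      · intro hne
        refine Runs.assign (by simp only [Expr.Fits]; omega) ?_
        refine ⟨by simp [State.setReg, h16], (hk₂.setReg (by omega)).setReg (by omega),
          by simp [State.setReg], .inr ⟨by simp [State.setReg, Expr.eval],
            fun hcons => hne (hev.2 fun h0 => ?_)⟩⟩
        exact ⟨(hcons u h0).1, (hcons u h0).2 v⟩
      · intro he
        refine Runs.weaken (Runs.nop ?_) (by omega)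
        refine ⟨h16, hk₂.setReg (by omega), by simp [State.setReg], ?_⟩
        simp only [State.setReg]
        rw [Function.update_of_ne (by omega)]
        refine hacc.imp_left fun h => ⟨h.1, fun u' v' hlt => ?_⟩
        rcases Nat.lt_succ_iff_lt_or_eq.1 hlt with hlt | heq
        · exact h.2 u' v' hlt
        · have e1 : u' = u := Fin.ext (by
            simp only [u]
            rw [← heq, mul_comm, Nat.mul_add_div hpos, Nat.div_eq_of_lt v'.2, add_zero])
          have e2 : v' = v := Fin.ext (by
            simp only [v]
            rw [← heq, mul_comm, Nat.mul_add_mod, Nat.mod_eq_of_lt v'.2])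
          rw [e1, e2]
          exact hev.1 he
  refine Runs.weaken (Runs.seq (T₁ := 2) (Runs.assign (by simp only [Expr.Fits]; omega)
    ⟨(Keeps.refl _ s).setReg (by omega), by simp [State.setReg, Expr.eval]⟩)
    fun s₁ h => Runs.seq (hloop s₁ h) (T₂ := 2) ?_) ?_
  · rintro s₁ ⟨hk, -, hacc⟩
    refine Runs.assign trivial ⟨hk.setReg (by omega), ?_⟩
    simp only [State.setReg, Function.update_self, Expr.eval]
    refine hacc.imp_left fun h => ⟨h.1, fun u h0 => ⟨?_, fun v hv => ?_⟩⟩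
    -- The list condition does not involve the second vertex, so the pair `(u, u)` yields it.
    · have hlt : (u : ℕ) * I.n + u < I.n * I.n := by
        have := Nat.mul_le_mul_right I.n (Nat.succ_le_of_lt u.2)
        have h3 := u.2
        rw [Nat.succ_mul] at this; omega
      exact (h.2 u u hlt h0).1
    · have hlt : (u : ℕ) * I.n + v < I.n * I.n := by
        have := Nat.mul_le_mul_right I.n (Nat.succ_le_of_lt u.2)
        have h3 := v.2
        rw [Nat.succ_mul] at this; omega
      exact (h.2 u v hlt h0).2 hv
  · have hc : (conflictExpr q).cost = 35 := by simp [conflictExpr, Expr.cost]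
    rw [hc]
    have h1 := mul_pow_le I.n 60 2
    have h2 := pow_le_pow_base I.n (show 2 + 60 ≤ q + 100 by omega)
    have h3 : I.n * I.n * (35 + 1 + 2 + 3 + 7) + 12 ≤ 60 * (I.n + 2) ^ 2 := by nlinarith
    omega

/-! ### Polynomial-time tests for the game and for the levels. -/

/-- Decide `Instance.Ext`. -/
def extProg (q : ℕ) : ℕ → Program
  | 0 => consProg q
  | j + 1 => .seq (extProg q j) (.branch (.reg 1) (searchProg q j 1 0 (extProg q j)) .nop)

/-- Decide `Instance.Live`. -/
def liveProg (q σ : ℕ) : ℕ → Program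
  | 0 => extProg q σ
  | k + 1 => searchProg q (σ + k) q 1 (liveProg q σ k)

/-- Each round reruns the decider of the previous one for every vertex and colour. The number of
rounds is fixed in the program, so the exponent depends on `q` and `j` only. -/
lemma extProg_computes (q j : ℕ) : ∃ a, Computes q a j (extProg q j) fun I => I.Ext j := by
  induction j with
  | zero => exact consProg_computes q
  | succ j ih =>
    obtain ⟨a, ha⟩ := ih
    obtain ⟨b, hb⟩ := ha.search 1 0
    refine ⟨a + b + 4, fun I W s hW hs => ?_⟩
    have hWa : (I.n + 2) ^ a ≤ W := (pow_le_pow_base _ (by omega)).trans hW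
    have hWb : (I.n + 2) ^ b ≤ W := (pow_le_pow_base _ (by omega)).trans hW
    refine Runs.weaken (Runs.seq (ha I W s hWa hs) (T₂ := 1 + 1 + (I.n + 2) ^ b) ?_) ?_
    · rintro s₁ ⟨hk, hres⟩
      refine Runs.branch trivial (fun hne => ?_) (fun he => ?_)
      · have hp := (hres.resolve_right fun h => hne h.1).2
        refine (hb.computes I W s₁ hWb (hs.keeps hk)).mono le_rfl ?_
        rintro s₂ ⟨hk₂, hres₂⟩
        rw [hk.1] at hres₂
        refine ⟨(hk.mono (by omega)).trans hk₂, hres₂.imp (fun h => ⟨h.1, hp, h.2⟩)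
          (fun h => ⟨h.1, fun h' => h.2 h'.2⟩)⟩
      · have hp := (hres.resolve_left fun h => by simp [Expr.eval, h.1] at he)
        exact Runs.weaken (Runs.nop ⟨hk.mono (by omega), .inr ⟨hp.1, fun h => hp.2 h.1⟩⟩)
          (Nat.one_le_pow _ _ (by omega))
    · have h1 := pow_le_pow_base I.n (show a ≤ a + b by omega)
      have h2 := pow_le_pow_base I.n (show b ≤ a + b by omega)
      have h3 := mul_pow_le I.n 4 (a + b)
      have h4 : 1 ≤ (I.n + 2) ^ (a + b) := Nat.one_le_pow _ _ (by omega)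
      omega

lemma liveProg_computes (q σ k : ℕ) :
    ∃ a, Computes q a (σ + k) (liveProg q σ k) fun I => I.Live σ k := by
  induction k with
  | zero => exact extProg_computes q σ
  | succ k ih =>
    obtain ⟨a, ha⟩ := ih
    obtain ⟨b, hb⟩ := ha.search q 1
    exact ⟨b, hb.computes⟩

lemma liveProg_searches (q σ k : ℕ) :
    ∃ a, Searches q a (σ + k + 1) (liveProg q σ (k + 1)) fun I => I.Fails q 1 (I.Live σ k) := by
  obtain ⟨a, ha⟩ := liveProg_computes q σ k
  exact ha.search q 1

/-- Search an uncoloured vertex, in the hub if `thrQ = 1`. -/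
def openProg (q thrQ : ℕ) : Program := searchProg q 0 1 thrQ (.assign 1 (.const 0))

/-- The inner test always rejects, so every uncoloured vertex with the required hub indicator fails.
-/
lemma openProg_searches (q thrQ : ℕ) : ∃ a, Searches q a 1 (openProg q thrQ)
    fun I col v => v < I.n ∧ col v = 0 ∧ thrQ ≤ I.hub v := by
  have h : Computes q 1 0 (.assign 1 (.const 0)) fun _ _ => False := by
    intro I W s hW hs
    rw [pow_one] at hW ⊢
    refine Runs.weaken (Runs.assign (by simp only [Expr.Fits]; omega)
      ⟨(Keeps.refl _ _).setReg (by omega), .inr ⟨by simp [State.setReg, Expr.eval], id⟩⟩) ?_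
    simp only [Expr.cost]; omega
  obtain ⟨a, ha⟩ := h.search 1 thrQ
  refine ⟨a, fun I W s hW hs => ?_⟩
  unfold openProg
  have := ha I W s hW hs
  simpa only [Instance.fails_one_iff, not_false_eq_true, implies_true, and_true] using this

/-! ### One step of the backtracking search. -/

/-- Run the search `P`; if it finds a vertex, put it into register `4` and `x` into
register `5`. -/
def pickProg (P : Program) (x : ℕ) : Program :=
  .seq P (.branch (.reg 1) .nop
    (.seq (.assign 4 (.sub (.reg 6) (.const 1))) (.assign 5 (.const x))))

/-- Pick the last vertex found by the searches of `liveProg q σ k, …, liveProg q σ 1`. -/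
def scanProg (q σ : ℕ) : ℕ → Program
  | 0 => .nop
  | k + 1 => .seq (pickProg (liveProg q σ (k + 1)) q) (scanProg q σ k)

/-- Push the vertex in register `4`, with the number of colours to try in register `5`, on the
stack kept in the arrays `4` and `5`, and give it the first colour. -/
def pushProg : Program :=
  .seq (.store 4 (.reg 3) (.reg 4)) (.seq (.store 5 (.reg 3) (.reg 5))
    (.seq (.store 3 (.reg 4) (.const 1)) (.assign 3 (.add (.reg 3) (.const 1)))))

/-- Choose the vertex to branch on and push it; register `6` refers to an uncoloured vertex. -/
def choosePushProg (q σ δ : ℕ) : Program :=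
  .seq (.assign 4 (.sub (.reg 6) (.const 1))) (.seq (.assign 5 (.const q))
    (.seq (pickProg (openProg q 1) 1) (.seq (scanProg q σ δ) pushProg)))

/-- Visit a node of the search tree for the first time. -/
def visitProg (q σ δ : ℕ) : Program :=
  .seq (liveProg q σ 0) (.branch (.reg 1)
    (.seq (openProg q 0) (.branch (.reg 1) (.assign 2 (.const 2)) (choosePushProg q σ δ)))
    (.assign 2 (.const 1)))

/-- Go on to the next colour of the topmost vertex of the stack, or pop it. -/
def backProg : Program :=
  .branch (.reg 3)
    (.branch (.lt (.get 3 (.get 4 (.sub (.reg 3) (.const 1)))) (.get 5 (.sub (.reg 3) (.const 1))))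
      (.seq (.store 3 (.get 4 (.sub (.reg 3) (.const 1)))
        (.add (.get 3 (.get 4 (.sub (.reg 3) (.const 1)))) (.const 1))) (.assign 2 (.const 0)))
      (.seq (.store 3 (.get 4 (.sub (.reg 3) (.const 1))) (.const 0))
        (.assign 3 (.sub (.reg 3) (.const 1)))))
    (.assign 2 (.const 3))

/-- One step of the backtracking search. Register `2` holds the mode: `0` to visit a node, `1` to
backtrack, `2` for success and `3` for failure. -/
def stepProg (q σ δ : ℕ) : Program := .branch (.reg 2) backProg (visitProg q σ δ)

/-- The arrays and the registers `0`, `2`, `3` agree. -/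
def SameCore (s s' : State) : Prop :=
  s'.arr = s.arr ∧ s'.reg 0 = s.reg 0 ∧ s'.reg 2 = s.reg 2 ∧ s'.reg 3 = s.reg 3

lemma SameCore.trans {s s' s'' : State} (h : SameCore s s') (h' : SameCore s' s'') :
    SameCore s s'' :=
  ⟨h'.1.trans h.1, h'.2.1.trans h.2.1, h'.2.2.1.trans h.2.2.1, h'.2.2.2.trans h.2.2.2⟩

lemma Keeps.sameCore {m : ℕ} {s s' : State} (h : Keeps m s s') : SameCore s s' :=
  ⟨h.1, h.2 0 (by omega) (by omega) (by omega), h.2 2 (by omega) (by omega) (by omega),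
    h.2 3 (by omega) (by omega) (by omega)⟩

lemma SameCore.setReg {s s' : State} (h : SameCore s s') {r x : ℕ} (hr : r ≠ 0) (hr2 : r ≠ 2)
    (hr3 : r ≠ 3) : SameCore s (s'.setReg r x) := by
  refine ⟨h.1, ?_, ?_, ?_⟩ <;> simp only [State.setReg]
  · rw [Function.update_of_ne hr.symm, h.2.1]
  · rw [Function.update_of_ne hr2.symm, h.2.2.1]
  · rw [Function.update_of_ne hr3.symm, h.2.2.2]

lemma Valid.congr {q : ℕ} {I : Instance q} {s s' : State} (h : Valid I s)
    (ha : s'.arr = s.arr) (hr : s'.reg 0 = s.reg 0) : Valid I s' := by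
  obtain ⟨h0, h1, h2, h3, h4⟩ := h
  constructor
  · rw [hr, h0]
  all_goals rw [ha]; assumption

lemma Valid.sameCore {q : ℕ} {I : Instance q} {s s' : State} (h : Valid I s)
    (hk : SameCore s s') : Valid I s' := h.congr hk.1 hk.2.1

/-- An unsuccessful search leaves registers `4` and `5` unchanged, so in a sequence of picks the
last success prevails. -/
lemma Searches.pick {q a ℓ : ℕ} {P : Program} {f : Instance q → (ℕ → ℕ) → ℕ → Prop}
    (h : Searches q a ℓ P f) (x : ℕ) : ∃ b, ∀ (I : Instance q) (W : ℕ) (s : State),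
      (I.n + 2) ^ b ≤ W → Valid I s → Runs W ((I.n + 2) ^ b) (pickProg P x) s fun s' =>
        SameCore s s' ∧ ((∀ v, ¬ f I (s.arr 3) v) ∧ s'.reg 4 = s.reg 4 ∧ s'.reg 5 = s.reg 5 ∨
          f I (s.arr 3) (s'.reg 4) ∧ s'.reg 5 = x) := by
  refine ⟨a + (8 + 1) + x, fun I W s hW hs => ?_⟩
  have hWa : (I.n + 2) ^ a ≤ W := (pow_le_pow_base _ (by omega)).trans hW
  have hxW : x + 1 < W := (lt_pow_of_le I.n (by omega)).trans_le hW
  refine Runs.weaken (Runs.seq (h I W s hWa hs) (T₂ := 1 + 1 + 6) ?_)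
    ((add_const_le I.n a 8).trans (pow_le_pow_base _ (by omega)))
  rintro s₁ ⟨hk, hres⟩
  refine Runs.branch trivial (fun hne => ?_) (fun he => ?_)
  · have hres := hres.resolve_right fun h => hne h.1
    refine Runs.weaken (Runs.nop ⟨hk.sameCore, .inl ⟨hres.2, ?_, ?_⟩⟩) (by omega)
    · exact hk.2 4 (by omega) (by omega) (by omega)
    · exact hk.2 5 (by omega) (by omega) (by omega)
  · obtain ⟨v, hv, h6⟩ := (hres.resolve_left fun h => by simp [Expr.eval, h.1] at he).2
    refine Runs.seq (T₁ := 4) (T₂ := 2) (mid := fun s₂ => s₂ = s₁.setReg 4 v)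
      (Runs.assign ⟨trivial, by simp only [Expr.Fits]; omega⟩ (by simp [Expr.eval, h6])) ?_
    rintro s₂ rfl
    refine Runs.assign (by simp only [Expr.Fits]; omega) ⟨(hk.sameCore.setReg (by omega) (by omega)
      (by omega)).setReg (by omega) (by omega) (by omega), .inr ⟨?_, ?_⟩⟩
    · simpa [State.setReg] using hv
    · simp [State.setReg, Expr.eval]

/-- Levels are scanned downwards, so the surviving choice belongs to the lowest failing level `j +
1`, and all positive levels below it are live. -/
lemma scanProg_runs (q σ k : ℕ) : ∃ a, ∀ (I : Instance q) (W : ℕ) (s : State),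
    (I.n + 2) ^ a ≤ W → Valid I s → Runs W ((I.n + 2) ^ a) (scanProg q σ k) s fun s' =>
      SameCore s s' ∧
      ((∀ j < k, I.Live σ (j + 1) (s.arr 3)) ∧ s'.reg 4 = s.reg 4 ∧ s'.reg 5 = s.reg 5 ∨
        ∃ j < k, (∀ i < j, I.Live σ (i + 1) (s.arr 3)) ∧
          I.Fails q 1 (I.Live σ j) (s.arr 3) (s'.reg 4) ∧ s'.reg 5 = q) := by
  induction k with
  | zero =>
    refine ⟨0, fun I W s hW hs => ?_⟩
    exact Runs.nop ⟨⟨rfl, rfl, rfl, rfl⟩, .inl ⟨by simp, rfl, rfl⟩⟩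
  | succ k ih =>
    obtain ⟨a, ha⟩ := ih
    obtain ⟨b, hb⟩ := liveProg_searches q σ k
    obtain ⟨c, hc⟩ := hb.pick q
    refine ⟨a + c + 2, fun I W s hW hs => ?_⟩
    have hWa : (I.n + 2) ^ a ≤ W := (pow_le_pow_base _ (by omega)).trans hW
    have hWc : (I.n + 2) ^ c ≤ W := (pow_le_pow_base _ (by omega)).trans hW
    refine Runs.weaken (Runs.seq (hc I W s hWc hs) (T₂ := (I.n + 2) ^ a) ?_) ?_
    · rintro s₁ ⟨hk, hres⟩
      refine (ha I W s₁ hWa (hs.sameCore hk)).mono le_rfl ?_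
      rintro s₂ ⟨hk₂, hres₂⟩
      refine ⟨hk.trans hk₂, ?_⟩
      rw [hk.1] at hres₂
      rcases hres₂ with ⟨h1, h4, h5⟩ | ⟨j, hj, h1, h2, h3⟩
      · rcases hres with ⟨g1, g4, g5⟩ | ⟨g1, g5⟩
        · refine .inl ⟨fun j hj => ?_, h4.trans g4, h5.trans g5⟩
          rcases Nat.lt_succ_iff_lt_or_eq.1 hj with hj | rfl
          · exact h1 j hj
          · exact g1
        · exact .inr ⟨k, by omega, h1, by rwa [h4], h5.trans g5⟩
      · exact .inr ⟨j, by omega, h1, h2, h3⟩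
    · have h1 := pow_le_pow_base I.n (show a ≤ a + c by omega)
      have h2 := pow_le_pow_base I.n (show c ≤ a + c by omega)
      have h3 := mul_pow_le I.n 2 (a + c)
      omega

/-- A legitimate choice of the vertex `v` to branch on and the number `l` of colours to try. -/
def Instance.Choice {q : ℕ} (I : Instance q) (σ δ : ℕ) (col : ℕ → ℕ) (v l : ℕ) : Prop :=
  v < I.n ∧ col v = 0 ∧
    ((l = q ∧ ∀ u < I.n, col u = 0 → ¬ 1 ≤ I.hub u) ∨
     (l = 1 ∧ 1 ≤ I.hub v ∧ ∀ j < δ, I.Live σ (j + 1) col) ∨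
     (l = q ∧ 1 ≤ I.hub v ∧ ∃ k < δ, (∀ j < k, I.Live σ (j + 1) col) ∧
        ∃ c < q, ¬ I.Live σ k (Function.update col v (c + 1))))

/-- The arrays after pushing the vertex `v` with limit `l` at depth `d`. -/
def pushed (s : State) (v l d : ℕ) : State :=
  ((s.setArr 4 d v).setArr 5 d l).setArr 3 v 1

lemma pushProg_runs {W : ℕ} {s : State} {v l d : ℕ} (hW : d + 1 < W) (h3 : s.reg 3 = d)
    (h4 : s.reg 4 = v) (h5 : s.reg 5 = l) : Runs W 13 pushProg s fun s' =>
      s' = (pushed s v l d).setReg 3 (d + 1) := by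
  refine Runs.seq (T₁ := 3) (T₂ := 10) (mid := fun s₁ => s₁ = s.setArr 4 d v)
    (Runs.store trivial trivial (by simp [Expr.eval, h3, h4])) ?_
  rintro _ rfl
  refine Runs.seq (T₁ := 3) (T₂ := 7) (mid := fun s₁ => s₁ = (s.setArr 4 d v).setArr 5 d l)
    (Runs.store trivial trivial (by simp [Expr.eval, State.setArr, h3, h5])) ?_
  rintro _ rfl
  refine Runs.seq (T₁ := 3) (T₂ := 4) (mid := fun s₁ => s₁ = pushed s v l d)
    (Runs.store trivial (by simp only [Expr.Fits]; omega)
      (by simp [Expr.eval, State.setArr, h4, pushed])) ?_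
  rintro _ rfl
  have h3' : (pushed s v l d).reg 3 = d := h3
  refine Runs.assign ⟨trivial, by simp only [Expr.Fits]; omega, ?_⟩ ?_
  · simp only [Expr.eval, h3']; exact hW
  · simp only [Expr.eval, h3']

/-- Three candidates override each other in increasing priority: any uncoloured vertex with all
colours, an uncoloured hub vertex with one colour, and a vertex witnessing the first failing level
with all colours. These are the three cases of `Instance.Choice`. -/
lemma choosePushProg_runs (q σ δ : ℕ) : ∃ a, ∀ (I : Instance q) (W : ℕ) (s : State) (u : ℕ),
    (I.n + 2) ^ a ≤ W → Valid I s → s.reg 3 < I.n → u < I.n → s.arr 3 u = 0 → s.reg 6 = u + 1 →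
      Runs W ((I.n + 2) ^ a) (choosePushProg q σ δ) s fun s' => ∃ v l,
        I.Choice σ δ (s.arr 3) v l ∧ s'.arr = (pushed s v l (s.reg 3)).arr ∧
        s'.reg 0 = s.reg 0 ∧ s'.reg 2 = s.reg 2 ∧ s'.reg 3 = s.reg 3 + 1 := by
  obtain ⟨a, ha⟩ := openProg_searches q 1
  obtain ⟨b, hb⟩ := ha.pick 1
  obtain ⟨c, hc⟩ := scanProg_runs q σ δ
  refine ⟨b + c + 30 + q, fun I W s u hW hs hd hu hu0 h6 => ?_⟩
  have hWb : (I.n + 2) ^ b ≤ W := (pow_le_pow_base _ (by omega)).trans hW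
  have hWc : (I.n + 2) ^ c ≤ W := (pow_le_pow_base _ (by omega)).trans hW
  have hqW : q + 1 < W := (lt_pow_of_le I.n (by omega)).trans_le hW
  have hnW : (I.n + 2) ^ 1 ≤ W := (pow_le_pow_base _ (by omega)).trans hW
  rw [pow_one] at hnW
  refine Runs.weaken (Runs.seq (T₁ := 4) (T₂ := 2 + ((I.n + 2) ^ b + ((I.n + 2) ^ c + 13)))
    (mid := fun s₁ => s₁ = s.setReg 4 u)
    (Runs.assign ⟨trivial, by simp only [Expr.Fits]; omega⟩ (by simp [Expr.eval, h6])) ?_) ?_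
  · rintro _ rfl
    refine Runs.seq (mid := fun s₁ => SameCore s s₁ ∧ s₁.reg 4 = u ∧ s₁.reg 5 = q)
      (Runs.assign (by simp only [Expr.Fits]; omega) ⟨⟨rfl, rfl, rfl, rfl⟩, rfl, rfl⟩) ?_
    rintro s₁ ⟨hk₁, h4, h5⟩
    refine Runs.seq (hb I W s₁ hWb (hs.sameCore hk₁)) ?_
    rintro s₂ ⟨hk₂, hres₂⟩
    rw [hk₁.1, h4, h5] at hres₂
    have hk₂ := hk₁.trans hk₂
    refine Runs.seq (hc I W s₂ hWc (hs.sameCore hk₂)) ?_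
    rintro s₃ ⟨hk₃, hres₃⟩
    rw [hk₂.1] at hres₃
    have hk₃ := hk₂.trans hk₃
    refine (pushProg_runs (by rw [hk₃.2.2.2]; omega) rfl rfl rfl).mono le_rfl ?_
    rintro _ rfl
    refine ⟨s₃.reg 4, s₃.reg 5, ?_, ?_, ?_, ?_, ?_⟩
    · rcases hres₃ with ⟨h1, e4, e5⟩ | ⟨j, hj, h1, h2, e5⟩
      · rcases hres₂ with ⟨g1, f4, f5⟩ | ⟨g1, f5⟩
        · rw [e4, e5, f4, f5]
          exact ⟨hu, hu0, .inl ⟨rfl, fun v hv h0 h1 => g1 v ⟨hv, h0, h1⟩⟩⟩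
        · rw [e4, e5, f5]
          exact ⟨g1.1, g1.2.1, .inr (.inl ⟨rfl, g1.2.2, h1⟩)⟩
      · rw [Instance.fails_full_iff] at h2
        exact ⟨h2.1, h2.2.1, .inr (.inr ⟨e5, h2.2.2.1, j, hj, h1, h2.2.2.2⟩)⟩
    · simp [State.setReg, pushed, State.setArr, hk₃.1, hk₃.2.2.2]
    · simpa [State.setReg, pushed, State.setArr] using hk₃.2.1
    · simpa [State.setReg, pushed, State.setArr] using hk₃.2.2.1
    · simp [State.setReg, hk₃.2.2.2]
  · have h1 := pow_le_pow_base I.n (show b ≤ b + c by omega)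
    have h2 := pow_le_pow_base I.n (show c ≤ b + c by omega)
    have h3 := mul_pow_le I.n 21 (b + c)
    have h4 : 1 ≤ (I.n + 2) ^ (b + c) := Nat.one_le_pow _ _ (by omega)
    have h5 := pow_le_pow_base I.n (show b + c + 21 ≤ b + c + 30 + q by omega)
    omega

/-- What a visit to a node achieves. -/
def VisitPost {q : ℕ} (I : Instance q) (σ δ : ℕ) (s s' : State) : Prop :=
  s'.reg 0 = s.reg 0 ∧
  ((¬ I.Live σ 0 (s.arr 3) ∧ s'.reg 2 = 1 ∧ s'.arr = s.arr ∧ s'.reg 3 = s.reg 3) ∨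
   (I.Live σ 0 (s.arr 3) ∧ (∀ v < I.n, s.arr 3 v ≠ 0) ∧ s'.reg 2 = 2 ∧ s'.arr = s.arr ∧
      s'.reg 3 = s.reg 3) ∨
   (I.Live σ 0 (s.arr 3) ∧ ∃ v l, I.Choice σ δ (s.arr 3) v l ∧
      s'.arr = (pushed s v l (s.reg 3)).arr ∧ s'.reg 2 = 0 ∧ s'.reg 3 = s.reg 3 + 1))

open Classical in
/-- The number of uncoloured vertices. -/
noncomputable def Instance.openCount {q : ℕ} (I : Instance q) (col : ℕ → ℕ) : ℕ :=
  ((Finset.range I.n).filter fun v => col v = 0).card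

lemma stepProg_visit (q σ δ : ℕ) : ∃ a, ∀ (I : Instance q) (W : ℕ) (s : State),
    (I.n + 2) ^ a ≤ W → Valid I s → s.reg 2 = 0 → s.reg 3 + I.openCount (s.arr 3) = I.n →
      Runs W ((I.n + 2) ^ a) (stepProg q σ δ) s (VisitPost I σ δ s) := by
  classical
  obtain ⟨a, ha⟩ := liveProg_computes q σ 0
  obtain ⟨b, hb⟩ := openProg_searches q 0
  obtain ⟨c, hc⟩ := choosePushProg_runs q σ δ
  refine ⟨a + b + c + 20, fun I W s hW hs h2 h3 => ?_⟩
  have hWa : (I.n + 2) ^ a ≤ W := (pow_le_pow_base _ (by omega)).trans hW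
  have hWb : (I.n + 2) ^ b ≤ W := (pow_le_pow_base _ (by omega)).trans hW
  have hWc : (I.n + 2) ^ c ≤ W := (pow_le_pow_base _ (by omega)).trans hW
  have hW4 : 4 < W := (lt_pow_of_le I.n (by omega)).trans_le hW
  have hle : 1 + 1 + ((I.n + 2) ^ a + (1 + 1 + ((I.n + 2) ^ b + (1 + 1 + ((I.n + 2) ^ c + 2))))) ≤
      (I.n + 2) ^ (a + b + c + 20) := by
    have h1 := pow_le_pow_base I.n (show a ≤ a + b + c by omega)
    have h2 := pow_le_pow_base I.n (show b ≤ a + b + c by omega)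
    have h3 := pow_le_pow_base I.n (show c ≤ a + b + c by omega)
    have h4 := mul_pow_le I.n 20 (a + b + c)
    have h5 : 1 ≤ (I.n + 2) ^ (a + b + c) := Nat.one_le_pow _ _ (by omega)
    omega
  refine Runs.weaken (Runs.branch (T := (I.n + 2) ^ a + (1 + 1 + ((I.n + 2) ^ b +
    (1 + 1 + ((I.n + 2) ^ c + 2))))) trivial (fun hne => absurd h2 hne) (fun _ => ?_)) hle
  refine Runs.seq (ha I W s hWa hs) ?_
  rintro s₁ ⟨hk, hres⟩
  have hk := hk.sameCore
  refine Runs.branch trivial (fun hne => ?_) (fun he => ?_)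
  · have hlive := (hres.resolve_right fun h => hne h.1).2
    refine Runs.seq (hb I W s₁ hWb (hs.sameCore hk)) ?_
    rintro s₂ ⟨hk₂, hres₂⟩
    rw [hk.1] at hres₂
    have hk₂ := hk.trans hk₂.sameCore
    refine Runs.branch trivial (fun hne => ?_) (fun he => ?_)
    · have hall := (hres₂.resolve_right fun h => hne h.1).2
      refine Runs.weaken (Runs.assign (by simp only [Expr.Fits]; omega) ?_)
        (by simp only [Expr.cost]; omega)
      refine ⟨hk₂.2.1, .inr (.inl ⟨hlive, fun v hv h0 => hall v ⟨hv, h0, Nat.zero_le _⟩, rfl,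
        hk₂.1, hk₂.2.2.2⟩)⟩
    · obtain ⟨u, hu, h6⟩ := (hres₂.resolve_left fun h => by simp [Expr.eval, h.1] at he).2
      -- Depth plus uncoloured vertices is `n`; an uncoloured vertex therefore keeps the depth below
      -- `n`, and the stack index fits into a word.
      have hpos : 0 < I.openCount (s.arr 3) :=
        Finset.card_pos.2 ⟨u, Finset.mem_filter.2 ⟨Finset.mem_range.2 hu.1, hu.2.1⟩⟩
      refine (hc I W s₂ u hWc (hs.sameCore hk₂) (by rw [hk₂.2.2.2]; omega) hu.1
        (by rw [hk₂.1]; exact hu.2.1) h6).mono (by omega) ?_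
      rintro s₃ ⟨v, l, hch, harr, e0, e2, e3⟩
      rw [hk₂.1] at hch
      rw [hk₂.2.2.2] at e3
      refine ⟨e0.trans hk₂.2.1, .inr (.inr ⟨hlive, v, l, hch, ?_, ?_, e3⟩)⟩
      · rw [harr, hk₂.2.2.2]
        simp [pushed, State.setArr, hk₂.1]
      · rw [e2, hk₂.2.2.1, h2]
  · have hdead := (hres.resolve_left fun h => by simp [Expr.eval, h.1] at he).2
    refine Runs.weaken (Runs.assign (by simp only [Expr.Fits]; omega) ?_)
      (by simp only [Expr.cost]; omega)
    exact ⟨hk.2.1, .inl ⟨hdead, rfl, hk.1, hk.2.2.2⟩⟩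

lemma stepProg_back_zero (q σ δ : ℕ) {W : ℕ} {s : State} (hW : 3 < W) (h2 : s.reg 2 = 1)
    (h3 : s.reg 3 = 0) : Runs W 40 (stepProg q σ δ) s fun s' => s' = s.setReg 2 3 := by
  refine Runs.weaken (Runs.branch (T := 1 + 1 + 2) trivial (fun _ => ?_)
    (fun h => by simp [Expr.eval, h2] at h)) (by simp only [Expr.cost]; omega)
  refine Runs.branch trivial (fun h => absurd h3 h) (fun _ => ?_)
  exact Runs.assign (by simp only [Expr.Fits]; omega) rfl

/-- Array `3` stores a colour `c` as `c + 1`, so `s.arr 3 v < l` says that the next colour is still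
among the first `l`. -/
lemma stepProg_back_succ (q σ δ : ℕ) {W : ℕ} {s : State} {d v l : ℕ} (hW : 3 < W)
    (h2 : s.reg 2 = 1) (h3 : s.reg 3 = d + 1) (h4 : s.arr 4 d = v) (h5 : s.arr 5 d = l)
    (hvW : s.arr 3 v + 1 < W) : Runs W 40 (stepProg q σ δ) s fun s' =>
      (s.arr 3 v < l → s' = (s.setArr 3 v (s.arr 3 v + 1)).setReg 2 0) ∧
      (¬ s.arr 3 v < l → s' = (s.setArr 3 v 0).setReg 3 d) := by
  refine Runs.weaken (Runs.branch (T := 1 + 1 + (12 + 1 + (16 + 4))) trivial (fun _ => ?_)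
    (fun h => by simp [Expr.eval, h2] at h)) (by simp only [Expr.cost]; omega)
  refine Runs.branch trivial (fun _ => ?_) (fun h => by simp [Expr.eval, h3] at h)
  have h1W : 1 < W := by omega
  refine Runs.weaken (T₁ := 10 + 1 + (16 + 4)) (Runs.branch (T := 16 + 4) ?_ (fun h => ?_)
    (fun h => ?_)) (by omega)
  · simp only [Expr.Fits, h1W, and_self]
  · have hlt : s.arr 3 v < l := by
      by_contra hc
      simp [Expr.eval, h3, h4, h5, hc] at h
    refine Runs.weaken (Runs.seq (T₂ := 2) (mid := fun s₁ => s₁ = s.setArr 3 v (s.arr 3 v + 1))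
      (Runs.store ?_ ?_ ?_) ?_) ?_
    · simp only [Expr.Fits, true_and, h1W]
    · simp only [Expr.Fits, Expr.eval, h3, h4, Nat.add_sub_cancel, true_and, h1W, hvW]
    · simp [Expr.eval, h3, h4]
    · rintro _ rfl
      exact Runs.assign (by simp only [Expr.Fits]; omega) ⟨fun _ => rfl, fun h => absurd hlt h⟩
    · simp only [Expr.cost]; omega
  · have hlt : ¬ s.arr 3 v < l := by
      intro hc
      simp [Expr.eval, h3, h4, h5, hc] at h
    refine Runs.weaken (Runs.seq (T₂ := 4) (mid := fun s₁ => s₁ = s.setArr 3 v 0)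
      (Runs.store ?_ ?_ ?_) ?_) ?_
    · simp only [Expr.Fits, true_and, h1W]
    · simp only [Expr.Fits]; omega
    · simp [Expr.eval, h3, h4]
    · rintro _ rfl
      have h3' : (s.setArr 3 v 0).reg 3 = d + 1 := h3
      refine Runs.assign ?_ ⟨fun h => absurd h hlt, fun _ => ?_⟩
      · simp only [Expr.Fits, true_and, h1W]
      · simp [Expr.eval, h3']
    · simp only [Expr.cost]; omega

/-! ### The potential bounding the search tree. -/

namespace Instance

variable {q : ℕ} {I : Instance q}

open Classical in
/-- The number of uncoloured hub vertices. -/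
noncomputable def openHub (I : Instance q) (col : ℕ → ℕ) : ℕ :=
  ((Finset.range I.n).filter fun v => col v = 0 ∧ 1 ≤ I.hub v).card

lemma openCount_update {col : ℕ → ℕ} {v : ℕ} (hv : v < I.n) (h0 : col v = 0) (c : ℕ) :
    I.openCount (Function.update col v (c + 1)) + 1 = I.openCount col := by
  classical
  unfold openCount
  rw [← Finset.card_erase_add_one (s := (Finset.range I.n).filter fun v => col v = 0) (a := v)
    (by simp [hv, h0])]
  congr 2
  ext u
  by_cases hu : u = v
  · subst hu; simp
  · simp [hu]

lemma openHub_update {col : ℕ → ℕ} {v : ℕ} (hv : v < I.n) (h0 : col v = 0) (hQ : 1 ≤ I.hub v)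
    (c : ℕ) : I.openHub (Function.update col v (c + 1)) + 1 = I.openHub col := by
  classical
  unfold openHub
  rw [← Finset.card_erase_add_one (a := v)
    (s := (Finset.range I.n).filter fun v => col v = 0 ∧ 1 ≤ I.hub v) (by simp [hv, h0, hQ])]
  congr 2
  ext u
  by_cases hu : u = v
  · subst hu; simp
  · simp [hu]

/-- A failure of level `k` exhibits `k` uncoloured hub vertices coloured in turn. Hence the
exponents in `bound` are not truncated. -/
lemma le_openHub_of_not_live {σ k : ℕ} {col : ℕ → ℕ} (h : ¬ I.Live σ k col) :
    k ≤ I.openHub col := by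
  induction k generalizing col with
  | zero => exact Nat.zero_le _
  | succ k ih =>
    simp only [Live, not_forall, not_not, fails_full_iff] at h
    obtain ⟨v, hv, h0, hQ, c, -, hc⟩ := h
    have := ih hc
    have := openHub_update hv h0 hQ c
    omega

open Classical in
/-- The bound on the size of the search tree below the node `col`. -/
noncomputable def bound (I : Instance q) (σ δ : ℕ) (y : ℝ) (col : ℕ → ℕ) : ℝ :=
  if h : ∃ k, k ≤ δ ∧ ¬ I.Live σ k col then
    ((q : ℝ) ^ Nat.find h - 1) * y ^ (I.openHub col - Nat.find h)
  else y ^ I.openHub col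

end Instance

/-- The numbers `y` for which the search tree has at most `y ^ p` leaves up to a polynomial
factor. -/
structure IsBase (q δ : ℕ) (y : ℝ) : Prop where
  one_le : 1 ≤ y
  le : y ≤ q
  sub_one_le : ∀ k ≤ δ, (q : ℝ) ^ k - 1 ≤ y ^ k

namespace Instance

variable {q σ δ : ℕ} {I : Instance q} {y : ℝ} {col : ℕ → ℕ}

lemma bound_le (hy : IsBase q δ y) : I.bound σ δ y col ≤ y ^ I.openHub col := by
  classical
  have h0 : 0 ≤ y := zero_le_one.trans hy.one_le
  unfold bound
  split_ifs with h
  · obtain ⟨hk, hl⟩ := Nat.find_spec h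
    calc _ ≤ y ^ Nat.find h * y ^ (I.openHub col - Nat.find h) :=
          mul_le_mul_of_nonneg_right (hy.sub_one_le _ hk) (by positivity)
      _ = _ := by rw [← pow_add, Nat.add_sub_cancel' (le_openHub_of_not_live hl)]
  · exact le_rfl

lemma bound_nonneg (hy : IsBase q δ y) : 0 ≤ I.bound σ δ y col := by
  classical
  have h0 : 0 ≤ y := zero_le_one.trans hy.one_le
  unfold bound
  split_ifs with h
  · exact mul_nonneg (sub_nonneg.2 (one_le_pow₀ (hy.one_le.trans hy.le))) (by positivity)
  · positivity

/-- `bound` refers to the first failing level `m`; a later one gives a weaker estimate because (q^m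
- 1) y^j ≤ q^(m+j) - 1 for y ≤ q. At `k = 0` the estimate is `0`, so a dead node costs only its own
visit. -/
lemma bound_le_of_not_live (hy : IsBase q δ y) {k : ℕ} (hk : k ≤ δ) (hl : ¬ I.Live σ k col) :
    I.bound σ δ y col ≤ ((q : ℝ) ^ k - 1) * y ^ (I.openHub col - k) := by
  classical
  have h0 : 0 ≤ y := zero_le_one.trans hy.one_le
  have hq1 : (1 : ℝ) ≤ q := hy.one_le.trans hy.le
  have h : ∃ k, k ≤ δ ∧ ¬ I.Live σ k col := ⟨k, hk, hl⟩
  have hle := le_openHub_of_not_live hl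
  have hfk : Nat.find h ≤ k := Nat.find_min' h ⟨hk, hl⟩
  rw [bound, dif_pos h]
  obtain ⟨j, hj⟩ := Nat.exists_eq_add_of_le hfk
  generalize Nat.find h = m at *
  have e : I.openHub col - m = j + (I.openHub col - k) := by omega
  rw [e, pow_add, ← mul_assoc]
  refine mul_le_mul_of_nonneg_right ?_ (by positivity)
  have h1 : y ^ j ≤ (q : ℝ) ^ j := pow_le_pow_left₀ h0 hy.le _
  have h2 : (1 : ℝ) ≤ (q : ℝ) ^ j := one_le_pow₀ hq1
  have h3 : (1 : ℝ) ≤ (q : ℝ) ^ m := one_le_pow₀ hq1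
  rw [hj, pow_add]
  nlinarith

/-- At a node that is not dead the first failing level is positive, so q^m - 1 ≥ 1. This lets the
constant work at a node be charged to its potential. -/
lemma one_le_bound (hy : IsBase q δ y) (hq : 2 ≤ q) (hl : I.Live σ 0 col) :
    1 ≤ I.bound σ δ y col := by
  classical
  unfold bound
  split_ifs with h
  · obtain ⟨hk, hl'⟩ := Nat.find_spec h
    have hne : Nat.find h ≠ 0 := fun h0 => by rw [h0] at hl'; exact hl' hl
    have h1 : (q : ℝ) ^ 1 ≤ (q : ℝ) ^ Nat.find h :=
      pow_le_pow_right₀ (hy.one_le.trans hy.le) (Nat.one_le_iff_ne_zero.2 hne)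
    have h2 : (2 : ℝ) ≤ q := by exact_mod_cast hq
    have h3 : (1 : ℝ) ≤ y ^ (I.openHub col - Nat.find h) := one_le_pow₀ hy.one_le
    rw [pow_one] at h1
    nlinarith
  · exact one_le_pow₀ hy.one_le

lemma bound_eq_of_live (hl : ∀ k ≤ δ, I.Live σ k col) : I.bound σ δ y col = y ^ I.openHub col := by
  classical
  rw [bound, dif_neg]
  rintro ⟨k, hk, h⟩
  exact h (hl k hk)

lemma bound_eq_of_first {k : ℕ} (hk : k < δ) (hl : ∀ j ≤ k, I.Live σ j col)
    (hn : ¬ I.Live σ (k + 1) col) :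
    I.bound σ δ y col = ((q : ℝ) ^ (k + 1) - 1) * y ^ (I.openHub col - (k + 1)) := by
  classical
  have h : ∃ k, k ≤ δ ∧ ¬ I.Live σ k col := ⟨k + 1, hk, hn⟩
  have hf : Nat.find h = k + 1 := by
    rw [Nat.find_eq_iff]
    exact ⟨⟨hk, hn⟩, fun j hj h' => h'.2 (hl j (by omega))⟩
  rw [bound, dif_pos h, hf]

/-- The recursion behind the running time. The single child of a fully live node loses a factor y ≥
1. At first failing level k + 1, the bad colour contributes q^k - 1 and each other colour at most
y^k ≤ q^k, in units of y^(h-k-1); these add up to q^(k+1) - 1. -/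
lemma sum_bound_le (hy : IsBase q δ y) (hl0 : I.Live σ 0 col) {v l : ℕ}
    (hch : I.Choice σ δ col v l) (hQ : 1 ≤ I.hub v) :
    ∑ c ∈ Finset.range l, I.bound σ δ y (Function.update col v (c + 1)) ≤ I.bound σ δ y col := by
  classical
  have h0 : 0 ≤ y := zero_le_one.trans hy.one_le
  obtain ⟨hv, hv0, hch⟩ := hch
  have hopen : ∀ c, I.openHub (Function.update col v (c + 1)) = I.openHub col - 1 := fun c => by
    have := openHub_update hv hv0 hQ c
    omega
  have hchild : ∀ c, I.bound σ δ y (Function.update col v (c + 1)) ≤ y ^ (I.openHub col - 1) :=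
    fun c => (bound_le hy).trans_eq (by rw [hopen])
  rcases hch with ⟨-, h⟩ | ⟨rfl, -, hl⟩ | ⟨rfl, -, k, hk, hl, c₀, hc₀, hbad⟩
  · exact absurd hQ (h v hv hv0)
  · rw [Finset.sum_range_one, bound_eq_of_live (col := col) (fun k hk => by
      cases k with
      | zero => exact hl0
      | succ k => exact hl k hk)]
    exact (hchild 0).trans (pow_le_pow_right₀ hy.one_le (Nat.sub_le _ _))
  · have hn : ¬ I.Live σ (k + 1) col := fun h => h v (fails_full_iff.2 ⟨hv, hv0, hQ, c₀, hc₀, hbad⟩)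
    have hr := le_openHub_of_not_live hn
    rw [bound_eq_of_first hk (fun j hj => by
      cases j with
      | zero => exact hl0
      | succ j => exact hl j hj) hn, ← Finset.add_sum_erase _ _ (Finset.mem_range.2 hc₀)]
    have h1 := bound_le_of_not_live hy hk.le hbad
    have h2 : ∑ c ∈ (Finset.range l).erase c₀, I.bound σ δ y (Function.update col v (c + 1)) ≤
        ((l : ℝ) - 1) * y ^ (I.openHub col - 1) := by
      refine (Finset.sum_le_card_nsmul _ _ _ fun c _ => hchild c).trans_eq ?_
      rw [Finset.card_erase_of_mem (Finset.mem_range.2 hc₀), Finset.card_range, nsmul_eq_mul,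
        Nat.cast_sub (by omega), Nat.cast_one]
    rw [hopen] at h1
    have e1 : I.openHub col - 1 - k = I.openHub col - (k + 1) := by omega
    have e2 : I.openHub col - 1 = k + (I.openHub col - (k + 1)) := by omega
    rw [e1] at h1
    rw [e2, pow_add] at h2
    have h3 : y ^ k ≤ (l : ℝ) ^ k := pow_le_pow_left₀ h0 hy.le _
    have h4 : (0 : ℝ) ≤ y ^ (I.openHub col - (k + 1)) := by positivity
    have h5 : (1 : ℝ) ≤ l := hy.one_le.trans hy.le
    generalize y ^ (I.openHub col - (k + 1)) = z at *
    have h6 : ((l : ℝ) - 1) * (y ^ k * z) ≤ ((l : ℝ) - 1) * ((l : ℝ) ^ k * z) :=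
      mul_le_mul_of_nonneg_left (mul_le_mul_of_nonneg_right h3 h4) (by linarith)
    calc _ ≤ ((l : ℝ) ^ k - 1) * z + ((l : ℝ) - 1) * ((l : ℝ) ^ k * z) :=
          add_le_add h1 (h2.trans h6)
      _ = _ := by ring

end Instance

/-! ### Correctness and step count of the search. -/

/-- `Reach W T P k s s'`: `k` executions of `P`, each in time `T` and started with at most `1` in
register `2`, lead from `s` to `s'`. -/
inductive Reach (W T : ℕ) (P : Program) : ℕ → State → State → Prop where
  | refl (s : State) : Reach W T P 0 s s
  | step {k t : ℕ} {s s₁ s₂ : State} (h : s.reg 2 < 2) (he : Exec W P s t s₁) (ht : t ≤ T)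
      (hr : Reach W T P k s₁ s₂) : Reach W T P (k + 1) s s₂

lemma Reach.trans {W T k l : ℕ} {P : Program} {s s' s'' : State} (h : Reach W T P k s s')
    (h' : Reach W T P l s' s'') : Reach W T P (k + l) s s'' := by
  induction h with
  | refl => rwa [Nat.zero_add]
  | step h he ht _ ih =>
    rw [Nat.add_right_comm]
    exact .step h he ht (ih h')

lemma Reach.runs_loop {W T k : ℕ} {P : Program} {s s' : State} (hW : 2 < W)
    (h : Reach W T P k s s') (hs' : 2 ≤ s'.reg 2) :
    Runs W (k * (T + 4) + 4) (.loop (.lt (.reg 2) (.const 2)) P) s (· = s') := by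
  induction h with
  | refl s =>
    exact ⟨_, s, .loop_done ⟨trivial, hW⟩ (if_neg (not_lt.2 hs')),
      by simp [Expr.cost], rfl⟩
  | @step k t s s₁ s₂ h he ht _ ih =>
    obtain ⟨t', s'', e, ht', rfl⟩ := ih hs'
    refine ⟨_, s'', .loop_step ⟨trivial, hW⟩ (by simp [Expr.eval, h]) he e, ?_, rfl⟩
    have : (k + 1) * (T + 4) = k * (T + 4) + (T + 4) := by ring
    simp only [Expr.cost]; omega

/-- The search has ended with a complete colouring. -/
def Success {q : ℕ} (I : Instance q) (σ : ℕ) (s : State) : Prop :=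
  Valid I s ∧ s.reg 2 = 2 ∧ I.Live σ 0 (s.arr 3) ∧ ∀ v < I.n, s.arr 3 v ≠ 0

/-- The states agree but for the mode, scratch registers and the unused part of the stack. -/
structure SameNode (s s' : State) : Prop where
  reg0 : s'.reg 0 = s.reg 0
  reg3 : s'.reg 3 = s.reg 3
  arr0 : s'.arr 0 = s.arr 0
  arr1 : s'.arr 1 = s.arr 1
  arr2 : s'.arr 2 = s.arr 2
  arr3 : s'.arr 3 = s.arr 3
  arr4 : ∀ i < s.reg 3, s'.arr 4 i = s.arr 4 i
  arr5 : ∀ i < s.reg 3, s'.arr 5 i = s.arr 5 i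

/-- `s'` is the child of the node `s` in which `v` has been given the colour `c`. -/
structure IsChild (s : State) (v l c : ℕ) (s' : State) : Prop where
  reg0 : s'.reg 0 = s.reg 0
  reg2 : s'.reg 2 = 0
  reg3 : s'.reg 3 = s.reg 3 + 1
  arr0 : s'.arr 0 = s.arr 0
  arr1 : s'.arr 1 = s.arr 1
  arr2 : s'.arr 2 = s.arr 2
  arr3 : s'.arr 3 = Function.update (s.arr 3) v (c + 1)
  arr4 : ∀ i < s.reg 3, s'.arr 4 i = s.arr 4 i
  arr5 : ∀ i < s.reg 3, s'.arr 5 i = s.arr 5 i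
  top4 : s'.arr 4 (s.reg 3) = v
  top5 : s'.arr 5 (s.reg 3) = l

lemma IsChild.valid {q : ℕ} {I : Instance q} {s s' : State} {v l c : ℕ} (h : IsChild s v l c s')
    (hs : Valid I s) (hc : c < q) : Valid I s' := by
  refine ⟨h.reg0.trans hs.reg0, h.arr0.trans hs.arr0, h.arr1.trans hs.arr1, h.arr2.trans hs.arr2,
    fun u hu => ?_⟩
  rw [h.arr3, Function.update_apply]
  split_ifs
  · omega
  · exact hs.col_le u hu

/-- The children of a node are searched one after the other; `X c` bounds the number of steps
from the colour `c` on. -/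
lemma search_children {q σ δ W T : ℕ} {I : Instance q} (hqW : q + 2 < W) (hT : 40 ≤ T)
    {s : State} {v l : ℕ} (hv0 : s.arr 3 v = 0) (hlq : l ≤ q)
    (X : ℕ → ℝ) (hX : 0 ≤ X l)
    (hchild : ∀ c < l, ∀ s₁, IsChild s v l c s₁ → ∃ k s', Reach W T (stepProg q σ δ) k s₁ s' ∧
      (Success I σ s' ∧ (k : ℝ) ≤ X c ∨ s'.reg 2 = 1 ∧ SameNode s₁ s' ∧
        ¬ I.HasExt (Function.update (s.arr 3) v (c + 1)) ∧ (k : ℝ) + 1 + X (c + 1) ≤ X c)) :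
    ∀ m c, c + (m + 1) = l → ∀ s₁, IsChild s v l c s₁ →
      ∃ k s', Reach W T (stepProg q σ δ) k s₁ s' ∧ (k : ℝ) ≤ X c ∧
        (Success I σ s' ∨ s'.reg 2 = 1 ∧ SameNode s s' ∧
          ∀ c', c ≤ c' → c' < l → ¬ I.HasExt (Function.update (s.arr 3) v (c' + 1))) := by
  intro m
  induction m with
  | zero =>
    intro c hc s₁ h₁
    obtain ⟨k, s₂, hr, ⟨hsucc, hk⟩ | ⟨hm, h₂, hno, hk⟩⟩ := hchild c (by omega) s₁ h₁
    · exact ⟨k, s₂, hr, hk, .inl hsucc⟩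
    have h3 : s₂.reg 3 = s.reg 3 + 1 := h₂.reg3.trans h₁.reg3
    have hlt : s.reg 3 < s₁.reg 3 := by rw [h₁.reg3]; omega
    have h4 := (h₂.arr4 _ hlt).trans h₁.top4
    have h5 := (h₂.arr5 _ hlt).trans h₁.top5
    have hcol : s₂.arr 3 = Function.update (s.arr 3) v (c + 1) := h₂.arr3.trans h₁.arr3
    have hcv : s₂.arr 3 v = c + 1 := by rw [hcol, Function.update_self]
    obtain ⟨t, s₃, he, ht, -, hs₃⟩ := stepProg_back_succ q σ δ (by omega) hm h3 h4 h5
      (W := W) (by rw [hcv]; omega)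
    have hs₃ := hs₃ (by rw [hcv]; omega)
    subst hs₃
    refine ⟨k + 1, _, hr.trans (.step (by omega) he (by omega) (.refl _)), ?_, .inr ⟨hm, ?_, ?_⟩⟩
    · push_cast
      rw [show c + 1 = l from hc] at hk
      linarith
    · refine ⟨h₂.reg0.trans h₁.reg0, rfl, ?_, ?_, ?_, ?_, fun i hi => ?_, fun i hi => ?_⟩
      · simpa [State.setReg, State.setArr] using h₂.arr0.trans h₁.arr0
      · simpa [State.setReg, State.setArr] using h₂.arr1.trans h₁.arr1
      · simpa [State.setReg, State.setArr] using h₂.arr2.trans h₁.arr2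
      · simp only [State.setReg, State.setArr, Function.update_self, hcol, Function.update_idem]
        rw [← hv0, Function.update_eq_self]
      · simpa [State.setReg, State.setArr] using (h₂.arr4 i (by omega)).trans (h₁.arr4 i hi)
      · simpa [State.setReg, State.setArr] using (h₂.arr5 i (by omega)).trans (h₁.arr5 i hi)
    · intro c' h1 h2
      obtain rfl : c' = c := by omega
      exact hno
  | succ m ih =>
    intro c hc s₁ h₁
    obtain ⟨k, s₂, hr, ⟨hsucc, hk⟩ | ⟨hm, h₂, hno, hk⟩⟩ := hchild c (by omega) s₁ h₁
    · exact ⟨k, s₂, hr, hk, .inl hsucc⟩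
    have h3 : s₂.reg 3 = s.reg 3 + 1 := h₂.reg3.trans h₁.reg3
    have hlt : s.reg 3 < s₁.reg 3 := by rw [h₁.reg3]; omega
    have h4 := (h₂.arr4 _ hlt).trans h₁.top4
    have h5 := (h₂.arr5 _ hlt).trans h₁.top5
    have hcol : s₂.arr 3 = Function.update (s.arr 3) v (c + 1) := h₂.arr3.trans h₁.arr3
    have hcv : s₂.arr 3 v = c + 1 := by rw [hcol, Function.update_self]
    obtain ⟨t, s₃, he, ht, hs₃, -⟩ := stepProg_back_succ q σ δ (by omega) hm h3 h4 h5
      (W := W) (by rw [hcv]; omega)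
    have hs₃ := hs₃ (by rw [hcv]; omega)
    have hch : IsChild s v l (c + 1) s₃ := by
      subst hs₃
      refine ⟨h₂.reg0.trans h₁.reg0, rfl, h3, ?_, ?_, ?_, ?_, fun i hi => ?_, fun i hi => ?_, ?_,
        ?_⟩
      · simpa [State.setReg, State.setArr] using h₂.arr0.trans h₁.arr0
      · simpa [State.setReg, State.setArr] using h₂.arr1.trans h₁.arr1
      · simpa [State.setReg, State.setArr] using h₂.arr2.trans h₁.arr2
      · simp only [State.setReg, State.setArr, Function.update_self, hcol, Function.update_idem]
      · simpa [State.setReg, State.setArr] using (h₂.arr4 i (by omega)).trans (h₁.arr4 i hi)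
      · simpa [State.setReg, State.setArr] using (h₂.arr5 i (by omega)).trans (h₁.arr5 i hi)
      · simpa [State.setReg, State.setArr] using h4
      · simpa [State.setReg, State.setArr] using h5
    obtain ⟨k', s', hr', hk', hout⟩ := ih (c + 1) (by omega) s₃ hch
    refine ⟨k + (k' + 1), s', hr.trans (.step (by omega) he (by omega) hr'), ?_, ?_⟩
    · push_cast; linarith
    · refine hout.imp_right fun ⟨g1, g2, g3⟩ => ⟨g1, g2, fun c' h1 h2 => ?_⟩
      rcases h1.eq_or_lt with rfl | h1
      · exact hno
      · exact g3 c' h1 h2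

/-- From a node with `h` uncoloured vertices, the search finds a list colouring or returns to the
node having verified that there is none, in a number of steps proportional to `Instance.bound`. -/
lemma search_node {q σ δ W T : ℕ} {I : Instance q} {y : ℝ} (hq : 2 ≤ q) (hδ : 1 ≤ δ)
    (hI : IsHub I.G σ δ I.Q) (hy : IsBase q δ y) (hqW : q + 2 < W) (hT : 40 ≤ T)
    (hvisit : ∀ s, Valid I s → s.reg 2 = 0 → s.reg 3 + I.openCount (s.arr 3) = I.n →
      Runs W T (stepProg q σ δ) s (VisitPost I σ δ s)) (h : ℕ) :
    ∀ s, Valid I s → s.reg 2 = 0 → I.openCount (s.arr 3) = h → s.reg 3 + h = I.n →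
      ∃ k s', Reach W T (stepProg q σ δ) k s s' ∧
        (k : ℝ) ≤ 1 + 2 * q * h * I.bound σ δ y (s.arr 3) ∧
        (Success I σ s' ∨ s'.reg 2 = 1 ∧ SameNode s s' ∧ ¬ I.HasExt (s.arr 3)) := by
  induction h with
  | zero =>
    intro s hs h2 hh hd
    obtain ⟨t, s₁, he, ht, e0, ⟨hl, e2, ea, e3⟩ | ⟨hl, hall, e2, ea, e3⟩ | ⟨-, v, l, hch, -⟩⟩ :=
      hvisit s hs h2 (by omega)
    · refine ⟨1, s₁, .step (by omega) he ht (.refl _), by simp, .inr ⟨e2, ?_,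
        fun h => hl (h.ext σ)⟩⟩
      exact ⟨e0, e3, by rw [ea], by rw [ea], by rw [ea], by rw [ea], by simp [ea], by simp [ea]⟩
    · refine ⟨1, s₁, .step (by omega) he ht (.refl _), by simp, .inl ⟨?_, e2, by rwa [ea],
        by rwa [ea]⟩⟩
      exact hs.congr ea e0
    · have := Instance.openCount_update hch.1 hch.2.1 0
      omega
  | succ h ih =>
    intro s hs h2 hh hd
    have hb0 := Instance.bound_nonneg (I := I) (σ := σ) (col := s.arr 3) hy
    have hqh : (0 : ℝ) ≤ 2 * q * h := by positivity
    obtain ⟨t, s₁, he, ht, e0, ⟨hl, e2, ea, e3⟩ | ⟨hl, hall, e2, ea, e3⟩ | ⟨hl, v, l, hch, ea, e2,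
      e3⟩⟩ :=
      hvisit s hs h2 (by omega)
    · refine ⟨1, s₁, .step (by omega) he ht (.refl _), ?_, .inr ⟨e2, ?_, fun h => hl (h.ext σ)⟩⟩
      · have : 0 ≤ 2 * (q : ℝ) * ((h + 1 : ℕ) : ℝ) * I.bound σ δ y (s.arr 3) := by positivity
        push_cast at this ⊢; linarith
      · exact ⟨e0, e3, by rw [ea], by rw [ea], by rw [ea], by rw [ea], by simp [ea], by simp [ea]⟩
    · refine ⟨1, s₁, .step (by omega) he ht (.refl _), ?_,
        .inl ⟨hs.congr ea e0, e2, by rwa [ea], by rwa [ea]⟩⟩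
      have : 0 ≤ 2 * (q : ℝ) * ((h + 1 : ℕ) : ℝ) * I.bound σ δ y (s.arr 3) := by positivity
      push_cast at this ⊢; linarith
    have hb1 := Instance.one_le_bound hy hq hl
    obtain ⟨hv, hv0, hcases⟩ := id hch
    have hlq : l ≤ q := by rcases hcases with ⟨rfl, -⟩ | ⟨rfl, -⟩ | ⟨rfl, -⟩ <;> omega
    have hl1 : 1 ≤ l := by rcases hcases with ⟨rfl, -⟩ | ⟨rfl, -⟩ | ⟨rfl, -⟩ <;> omega
    have hfirst : IsChild s v l 0 s₁ := by
      refine ⟨e0, e2, e3, ?_, ?_, ?_, ?_, fun i hi => ?_, fun i hi => ?_, ?_, ?_⟩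
      · simp [ea, pushed, State.setArr]
      · simp [ea, pushed, State.setArr]
      · simp [ea, pushed, State.setArr]
      · simp [ea, pushed, State.setArr]
      · simp [ea, pushed, State.setArr, Function.update_of_ne hi.ne]
      · simp [ea, pushed, State.setArr, Function.update_of_ne hi.ne]
      · simp [ea, pushed, State.setArr]
      · simp [ea, pushed, State.setArr]
    have hrec : ∀ c < l, ∀ s₁, IsChild s v l c s₁ → ∃ k s', Reach W T (stepProg q σ δ) k s₁ s' ∧
        (k : ℝ) ≤ 1 + 2 * q * h * I.bound σ δ y (Function.update (s.arr 3) v (c + 1)) ∧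
        (Success I σ s' ∨ s'.reg 2 = 1 ∧ SameNode s₁ s' ∧
          ¬ I.HasExt (Function.update (s.arr 3) v (c + 1))) := by
      intro c hc s₁ h₁
      have hcount := Instance.openCount_update hv hv0 c
      have := ih s₁ (h₁.valid hs (by omega)) h₁.reg2 (by rw [h₁.arr3]; omega)
        (by rw [h₁.reg3]; omega)
      rwa [h₁.arr3] at this
    -- When all `q` colours are tried, an extension of the node extends the child in which `v` gets
    -- its own colour.
    have hfull : l = q → (∀ c', 0 ≤ c' → c' < l →
        ¬ I.HasExt (Function.update (s.arr 3) v (c' + 1))) → ¬ I.HasExt (s.arr 3) := by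
      rintro rfl hno ⟨φ, hL, hφ⟩
      exact hno (φ ⟨v, hv⟩) (Nat.zero_le _) (φ ⟨v, hv⟩).2 ⟨φ, hL, hφ.update ⟨v, hv⟩⟩
    have finish : ∀ X : ℕ → ℝ, 0 ≤ X l → X 0 ≤ 2 * q * (h + 1) * I.bound σ δ y (s.arr 3) →
        (∀ c < l, ∀ s₁, IsChild s v l c s₁ → ∃ k s', Reach W T (stepProg q σ δ) k s₁ s' ∧
          (Success I σ s' ∧ (k : ℝ) ≤ X c ∨ s'.reg 2 = 1 ∧ SameNode s₁ s' ∧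
          ¬ I.HasExt (Function.update (s.arr 3) v (c + 1)) ∧ (k : ℝ) + 1 + X (c + 1) ≤ X c)) →
        ((∀ c', 0 ≤ c' → c' < l → ¬ I.HasExt (Function.update (s.arr 3) v (c' + 1))) →
          ¬ I.HasExt (s.arr 3)) →
        ∃ k s', Reach W T (stepProg q σ δ) k s s' ∧
          (k : ℝ) ≤ 1 + 2 * q * ((h + 1 : ℕ) : ℝ) * I.bound σ δ y (s.arr 3) ∧
          (Success I σ s' ∨ s'.reg 2 = 1 ∧ SameNode s s' ∧ ¬ I.HasExt (s.arr 3)) := by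
      intro X hX hX0 hX1 hno
      obtain ⟨k, s', hr, hk, hout⟩ := search_children hqW hT hv0 hlq X hX hX1 (l - 1) 0 (by omega)
        s₁ hfirst
      refine ⟨k + 1, s', .step (by omega) he ht hr, ?_, ?_⟩
      · push_cast; linarith
      · exact hout.imp_right fun ⟨g1, g2, g3⟩ => ⟨g1, g2, hno g3⟩
    by_cases hQ : 1 ≤ I.hub v
    · have hsum := Instance.sum_bound_le hy hl hch hQ
      -- The child's bound 1 + 2qh · `bound`, plus one step for backtracking from it. Over all
      -- children this is at most 2l + 2qh · `bound` of the node, and `1 ≤ bound` absorbs 2l into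
      -- one more unit of h.
      set w : ℕ → ℝ := fun c =>
        2 + 2 * q * h * I.bound σ δ y (Function.update (s.arr 3) v (c + 1)) with hw
      have hw0 : ∀ c, 0 ≤ w c := fun c => by
        have := Instance.bound_nonneg (I := I) (σ := σ)
          (col := Function.update (s.arr 3) v (c + 1)) hy
        simp only [hw]; positivity
      refine finish (fun c => ∑ c' ∈ Finset.Ico c l, w c') (by simp) ?_ ?_ ?_
      · have hlq' : (l : ℝ) ≤ q := by exact_mod_cast hlq
        simp only [Nat.Ico_zero_eq_range, hw, Finset.sum_add_distrib, ← Finset.mul_sum,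
          Finset.sum_const, Finset.card_range, nsmul_eq_mul]
        nlinarith [mul_le_mul_of_nonneg_left hsum hqh]
      · intro c hc s₁ h₁
        obtain ⟨k, s', hr, hk, hout⟩ := hrec c hc s₁ h₁
        have hX : ∑ c' ∈ Finset.Ico c l, w c' = w c + ∑ c' ∈ Finset.Ico (c + 1) l, w c' :=
          Finset.sum_eq_sum_Ico_succ_bot hc w
        have hX0 : 0 ≤ ∑ c' ∈ Finset.Ico (c + 1) l, w c' := Finset.sum_nonneg fun i _ => hw0 i
        refine ⟨k, s', hr, hout.imp (fun hsucc => ⟨hsucc, ?_⟩) fun ⟨g1, g2, g3⟩ => ⟨g1, g2, g3, ?_⟩⟩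
        · rw [hX]; simp only [hw] at hX0 ⊢; linarith
        · rw [hX]; simp only [hw]; linarith
      · rcases hcases with ⟨rfl, -⟩ | ⟨rfl, -, hlive⟩ | ⟨rfl, -⟩
        · exact hfull rfl
        -- Here only colour `0` was tried: an extension of the node could be recoloured to give `v`
        -- that colour.
        · intro hno hext
          refine hno 0 le_rfl one_pos (hext.update_of_live hδ hI (fun k hk => ?_)
            hv hv0 hQ (by omega))
          cases k with
          | zero => exact hl
          | succ k => exact hlive k hk
        · exact hfull rfl
    · obtain ⟨rfl, hno⟩ : l = q ∧ ∀ u < I.n, s.arr 3 u = 0 → ¬ 1 ≤ I.hub u := by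
        rcases hcases with h | h | h
        · exact h
        · exact absurd h.2.1 hQ
        · exact absurd h.2.1 hQ
      -- The hub is fully coloured. A child without an extension is then dead and costs one visit
      -- and one backtrack, hence the term 2(l - c). A child ending in success has potential at most
      -- `1`, and 2lh pays for it once.
      refine finish (fun c => 2 * ((l : ℝ) - c) + 2 * l * h) (by simp; positivity) ?_ ?_ (hfull rfl)
      · have : 0 ≤ 2 * (l : ℝ) * (h + 1) := by positivity
        simp only [Nat.cast_zero, sub_zero]
        nlinarith [mul_le_mul_of_nonneg_left hb1 this]
      · intro c hc s₁ h₁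
        obtain ⟨k, s', hr, hk, hout⟩ := hrec c hc s₁ h₁
        have hcl : (c : ℝ) + 1 ≤ l := by exact_mod_cast hc
        have hopen : ∀ u < I.n, 1 ≤ I.hub u → Function.update (s.arr 3) v (c + 1) u ≠ 0 := by
          intro u hu hQu
          have huv : u ≠ v := by rintro rfl; exact hQ hQu
          rw [Function.update_of_ne huv]
          exact fun h0 => hno u hu h0 hQu
        refine ⟨k, s', hr, hout.imp (fun hsucc => ⟨hsucc, ?_⟩) fun ⟨g1, g2, g3⟩ => ⟨g1, g2, g3, ?_⟩⟩
        · have hz : I.openHub (Function.update (s.arr 3) v (c + 1)) = 0 := by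
            classical
            rw [Instance.openHub, Finset.card_eq_zero, Finset.filter_eq_empty_iff]
            rintro u hu ⟨h0, h1⟩
            exact hopen u (Finset.mem_range.1 hu) h1 h0
          have hb := Instance.bound_le (I := I) (σ := σ)
            (col := Function.update (s.arr 3) v (c + 1)) hy
          rw [hz, pow_zero] at hb
          nlinarith [mul_le_mul_of_nonneg_left hb hqh]
        · have hdead : ¬ I.Live σ 0 (Function.update (s.arr 3) v (c + 1)) := fun hlv =>
            g3 (Instance.hasExt_of_ext (by omega) hI hlv hopen)
          have hb := Instance.bound_le_of_not_live hy (Nat.zero_le δ) hdead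
          rw [pow_zero, sub_self, zero_mul] at hb
          have hk1 : (k : ℝ) ≤ 1 := by nlinarith [mul_le_mul_of_nonneg_left hb hqh]
          push_cast; linarith

/-! ### The complete program and its running time. -/

/-- The whole algorithm: search, then write out the answer. -/
def mainProg (q σ δ : ℕ) : Program :=
  .seq (.loop (.lt (.reg 2) (.const 2)) (stepProg q σ δ))
    (.branch (.eq (.reg 2) (.const 2))
      (.seq (forLoop 16 (.reg 0) (.store 0 (.reg 16) (.sub (.get 3 (.reg 16)) (.const 1))))
        (.assign 0 (.const 1)))
      (.assign 0 (.const 0)))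

lemma output_runs {W n : ℕ} {s : State} (hn : n + 1 < W) (h0 : s.reg 0 = n) :
    Runs W (n * (6 + 1 + 7) + 1 + 5 + 2)
      (.seq (forLoop 16 (.reg 0) (.store 0 (.reg 16) (.sub (.get 3 (.reg 16)) (.const 1))))
        (.assign 0 (.const 1))) s
      fun s' => s'.reg 0 = 1 ∧ ∀ v < n, s'.arr 0 v = s.arr 3 v - 1 := by
  let J : ℕ → State → Prop := fun i s' => s'.reg 0 = n ∧ s'.reg 16 = i ∧ s'.arr 3 = s.arr 3 ∧
    ∀ v < i, s'.arr 0 v = s.arr 3 v - 1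
  have hloop : Runs W (n * (6 + 1 + 7) + 1 + 5)
      (forLoop 16 (.reg 0) (.store 0 (.reg 16) (.sub (.get 3 (.reg 16)) (.const 1)))) s (J n) := by
    refine Runs.forLoop J (by omega) ⟨by simpa [State.setReg] using h0, by simp [State.setReg], rfl,
      by simp⟩ (fun i s' h => ⟨trivial, h.1⟩) (fun i s' h => h.2.1) ?_ (fun _ h => h)
    rintro i hi s' ⟨g0, g16, g3, gv⟩
    refine Runs.weaken (Runs.store trivial ⟨trivial, by simp only [Expr.Fits]; omega⟩ ?_)
      (by simp [Expr.cost])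
    refine ⟨g16, g0, by simp [State.setReg], by simpa [State.setReg, State.setArr] using g3, ?_⟩
    intro v hv
    simp only [State.setReg, State.setArr, Function.update_self, Function.update_apply, Expr.eval,
      g16, g3]
    split_ifs with hvi
    · rw [hvi]
    · exact gv v (by omega)
  refine Runs.seq hloop (T₂ := 2) ?_
  rintro s₁ ⟨-, -, -, hv⟩
  exact Runs.assign (by simp only [Expr.Fits]; omega) ⟨by simp [State.setReg, Expr.eval], hv⟩

lemma valid_input {q : ℕ} (I : Instance q) : Valid I I.input :=
  ⟨rfl, rfl, rfl, rfl, fun _ _ => Nat.zero_le q⟩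

lemma openCount_zero {q : ℕ} (I : Instance q) : I.openCount (fun _ => 0) = I.n := by
  simp [Instance.openCount]

lemma openHub_zero_le {q : ℕ} (I : Instance q) : I.openHub (fun _ => 0) ≤ I.Q.card := by
  classical
  refine (Finset.card_le_card (t := I.Q.image Fin.val) fun v hv => ?_).trans Finset.card_image_le
  obtain ⟨h1, -, h2⟩ := Finset.mem_filter.1 hv
  have h1 := Finset.mem_range.1 h1
  exact Finset.mem_image.2 ⟨⟨v, h1⟩, (Instance.one_le_hub ⟨v, h1⟩).1 h2, rfl⟩

/-- If the steps of the search take time at most `T`, the algorithm solves the instance in time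
`O(n * y ^ p * T)`. -/
lemma mainProg_runs {q σ δ W T : ℕ} {I : Instance q} {y : ℝ} (hq : 2 ≤ q) (hδ : 1 ≤ δ)
    (hI : IsHub I.G σ δ I.Q) (hy : IsBase q δ y) (hqW : q + 2 < W) (hnW : I.n + 2 < W)
    (hT : 40 ≤ T)
    (hvisit : ∀ s, Valid I s → s.reg 2 = 0 → s.reg 3 + I.openCount (s.arr 3) = I.n →
      Runs W T (stepProg q σ δ) s (VisitPost I σ δ s)) :
    ∃ k : ℕ, (k : ℝ) ≤ 2 + 2 * q * I.n * y ^ I.Q.card ∧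
      Runs W (k * (T + 4) + 4 + (3 + 1 + (I.n * (6 + 1 + 7) + 1 + 5 + 2)))
        (mainProg q σ δ) I.input (IsAnswer I.G I.L) := by
  obtain ⟨k, s₁, hr, hk, hout⟩ := search_node hq hδ hI hy hqW hT hvisit I.n I.input
    (valid_input I) rfl (openCount_zero I) (Nat.zero_add I.n)
  have hbound : I.bound σ δ y (I.input.arr 3) ≤ y ^ I.Q.card :=
    (Instance.bound_le hy).trans (pow_le_pow_right₀ hy.one_le (openHub_zero_le I))
  have main : ∃ k s', Reach W T (stepProg q σ δ) k I.input s' ∧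
      (k : ℝ) ≤ 2 + 2 * q * I.n * y ^ I.Q.card ∧
      (Success I σ s' ∨ s'.reg 2 = 3 ∧ ¬ I.HasExt (I.input.arr 3)) := by
    have hkk : (k : ℝ) ≤ 1 + 2 * q * I.n * y ^ I.Q.card :=
      hk.trans (add_le_add_right (mul_le_mul_of_nonneg_left hbound (by positivity)) 1)
    rcases hout with hsucc | ⟨h2, hsame, hno⟩
    · exact ⟨k, s₁, hr, by linarith, .inl hsucc⟩
    · have h3 : s₁.reg 3 = 0 := hsame.reg3
      obtain ⟨t, s₂, he, ht, hs₂⟩ := stepProg_back_zero q σ δ (W := W) (by omega) h2 h3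
      refine ⟨k + 1, s₂, hr.trans (.step (by omega) he (by omega) (.refl _)), ?_,
        .inr ⟨by simp [hs₂, State.setReg], hno⟩⟩
      push_cast; linarith
  obtain ⟨k, s₂, hr, hk, hout⟩ := main
  refine ⟨k, hk, ?_⟩
  have hfin : 2 ≤ s₂.reg 2 := by
    rcases hout with h | h
    · exact h.2.1.ge
    · omega
  refine Runs.seq (hr.runs_loop (by omega) hfin) ?_
  intro s₃ hs₃
  subst hs₃
  refine Runs.branch ⟨trivial, by simp only [Expr.Fits]; omega⟩ (fun hne => ?_) (fun he => ?_)
  · have h2 : s₃.reg 2 = 2 := by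
      by_contra h
      simp [Expr.eval, h] at hne
    have hsucc : Success I σ s₃ := hout.resolve_right fun h => by omega
    obtain ⟨hval, -, hlive, hall⟩ := hsucc
    obtain ⟨φ, hL, hφ⟩ := Instance.hasExt_of_ext (by omega) hI hlive fun v hv _ => hall v hv
    refine (output_runs (by omega) hval.reg0).mono le_rfl fun s' ⟨e0, ev⟩ => ?_
    refine .inl ⟨e0, φ, hL, fun v => ?_⟩
    rw [ev v v.2, hφ v (hall v v.2)]
    exact Nat.add_sub_cancel _ _
  · have hno : ¬ I.HasExt (I.input.arr 3) := by
      rcases hout with h | h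
      · simp [Expr.eval, h.2.1] at he
      · exact h.2
    refine Runs.weaken (Runs.assign (by simp only [Expr.Fits]; omega) ?_)
      (by simp only [Expr.cost]; omega)
    refine .inr ⟨by simp [State.setReg, Expr.eval], fun ⟨φ, hφ⟩ => hno ⟨φ, hφ, ?_⟩⟩
    -- Array `3` is initially zero, so every colouring extends the starting position.
    exact fun v h0 => absurd rfl h0

lemma time_le (q n b : ℕ) : (2 + 2 * q * n) * ((n + 2) ^ b + 4) + (n * 14 + 16) ≤
    (n + 2) ^ (b + 1 + (5 * (2 * q + 2) + 14)) := by
  have h1 : 1 ≤ (n + 2) ^ b := Nat.one_le_pow _ _ (by omega)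
  have h2 : (2 + 2 * q * n) ≤ (2 * q + 2) * (n + 2) := by nlinarith
  have h3 : (n + 2) ^ b + 4 ≤ 5 * (n + 2) ^ b := by omega
  have h4 : n * 14 + 16 ≤ 14 * (n + 2) * (n + 2) ^ b :=
    (show n * 14 + 16 ≤ 14 * (n + 2) by omega).trans (Nat.le_mul_of_pos_right _ (by omega))
  calc _ ≤ (2 * q + 2) * (n + 2) * (5 * (n + 2) ^ b) + 14 * (n + 2) * (n + 2) ^ b :=
        Nat.add_le_add (Nat.mul_le_mul h2 h3) h4
    _ = (5 * (2 * q + 2) + 14) * (n + 2) ^ (b + 1) := by ring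
    _ ≤ _ := mul_pow_le n _ _

/-- List `q`-Colouring with a `(σ, δ)`-hub of size `p` can be solved in time
`y ^ p * n ^ O(1)`. -/
theorem solvableInTime_of_isBase {q δ : ℕ} {y : ℝ} (hq : 2 ≤ q) (hδ : 1 ≤ δ) (hy : IsBase q δ y)
    (σ : ℕ) : SolvableInTime q σ δ fun p => y ^ p := by
  obtain ⟨a, ha⟩ := stepProg_visit q σ δ
  -- The summand 40 lets the same power of n + 2 also cover a backtracking step, which takes at most
  -- 40 units.
  obtain ⟨b, hb⟩ : ∃ b, b = a + 40 := ⟨_, rfl⟩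
  obtain ⟨c, hc⟩ : ∃ c, c = b + 1 + (5 * (2 * q + 2) + 14) := ⟨_, rfl⟩
  refine ⟨mainProg q σ δ, c, fun n G L Q hI => ?_⟩
  obtain ⟨k, hk, t, s', he, ht, hans⟩ := mainProg_runs (I := ⟨n, G, L, Q⟩) (W := (n + 2) ^ c)
    (T := (n + 2) ^ b) hq hδ hI hy (lt_pow_of_le n (by omega))
    (by
      have : n + 2 < (n + 2) ^ 2 := by nlinarith
      exact this.trans_le (pow_le_pow_base n (by omega)))
    (lt_pow_of_le n (by omega)).le
    (fun s h1 h2 h3 => Runs.weaken (ha _ _ s (pow_le_pow_base n (by omega)) h1 h2 h3)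
      (pow_le_pow_base n (by omega)))
  refine ⟨t, s', he, ?_, hans⟩
  have hyp : (1 : ℝ) ≤ y ^ Q.card := one_le_pow₀ hy.one_le
  have hN := time_le q n b
  rw [← hc] at hN
  calc (t : ℝ) ≤ ((k * ((n + 2) ^ b + 4) + 4 + (3 + 1 + (n * (6 + 1 + 7) + 1 + 5 + 2)) : ℕ) : ℝ) :=
        Nat.cast_le.2 ht
    _ = k * (((n : ℝ) + 2) ^ b + 4) + (n * 14 + 16) := by push_cast; ring
    _ ≤ ((2 + 2 * q * n) * y ^ Q.card) * (((n : ℝ) + 2) ^ b + 4) +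
        y ^ Q.card * (n * 14 + 16) := by
        refine add_le_add (mul_le_mul_of_nonneg_right (hk.trans ?_) (by positivity)) ?_
        · change 2 + 2 * (q : ℝ) * n * y ^ Q.card ≤ _
          linarith
        · exact le_mul_of_one_le_left (by positivity) hyp
    _ = y ^ Q.card * (((2 + 2 * q * n) * ((n + 2) ^ b + 4) + (n * 14 + 16) : ℕ) : ℝ) := by
        push_cast; ring
    _ ≤ y ^ Q.card * (((n + 2) ^ c : ℕ) : ℝ) :=
        mul_le_mul_of_nonneg_left (Nat.cast_le.2 hN) (by linarith)
    _ = y ^ Q.card * ((n : ℝ) + 2) ^ c := by push_cast; ring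

/-! ### The base (q^δ - 1)^(1/δ) and the theorem. -/

lemma IsHub.mono {V : Type*} [Finite V] {G : SimpleGraph V} {σ δ δ' : ℕ} {Q : Finset V}
    (h : IsHub G σ δ Q) (hδ : δ ≤ δ') : IsHub G σ δ' Q :=
  fun C => ⟨(h C).1, (h C).2.trans hδ⟩

lemma SolvableInTime.mono {q σ δ δ' : ℕ} {f : ℕ → ℝ} (h : SolvableInTime q σ δ' f)
    (hδ : δ ≤ δ') : SolvableInTime q σ δ f := by
  obtain ⟨P, c, hP⟩ := h
  exact ⟨P, c, fun n G L Q hI => hP n G L Q (hI.mono hδ)⟩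

/-- Dividing by x^(kδ) leaves (1 - x^(-k))^δ ≤ (1 - x^(-δ))^k: the left side has the smaller base in
[0, 1] and the larger exponent. -/
lemma pow_sub_one_pow_le {x : ℝ} (hx : 1 ≤ x) {k δ : ℕ} (hk : k ≤ δ) :
    (x ^ k - 1) ^ δ ≤ (x ^ δ - 1) ^ k := by
  have hx0 : 0 < x := by linarith
  have hk1 : 1 ≤ x ^ k := one_le_pow₀ hx
  have hδ1 : 1 ≤ x ^ δ := one_le_pow₀ hx
  have hle : x ^ k ≤ x ^ δ := pow_le_pow_right₀ hx hk
  have hu : 0 ≤ 1 - (x ^ k)⁻¹ := sub_nonneg.2 (inv_le_one_of_one_le₀ hk1)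
  have hw : 0 ≤ 1 - (x ^ δ)⁻¹ := sub_nonneg.2 (inv_le_one_of_one_le₀ hδ1)
  have huw : 1 - (x ^ k)⁻¹ ≤ 1 - (x ^ δ)⁻¹ :=
    sub_le_sub_left (inv_anti₀ (by positivity) hle) _
  have hw1 : 1 - (x ^ δ)⁻¹ ≤ 1 := sub_le_self _ (by positivity)
  have e1 : x ^ k - 1 = x ^ k * (1 - (x ^ k)⁻¹) := by field_simp
  have e2 : x ^ δ - 1 = x ^ δ * (1 - (x ^ δ)⁻¹) := by field_simp
  rw [e1, e2, mul_pow, mul_pow, ← pow_mul, ← pow_mul, mul_comm δ k]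
  refine mul_le_mul_of_nonneg_left ?_ (by positivity)
  exact (pow_le_pow_left₀ hu huw δ).trans (pow_le_pow_of_le_one hw hw1 hk)

/-- The real number `(q ^ δ - 1) ^ (1 / δ)`. -/
noncomputable def base (q δ : ℕ) : ℝ := ((q : ℝ) ^ δ - 1) ^ ((1 : ℝ) / δ)

lemma base_pow_self {q δ : ℕ} (hq : 1 ≤ q) (hδ : 1 ≤ δ) : base q δ ^ δ = (q : ℝ) ^ δ - 1 := by
  have h0 : (0 : ℝ) ≤ (q : ℝ) ^ δ - 1 :=
    sub_nonneg.2 (one_le_pow₀ (by exact_mod_cast hq))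
  rw [base, one_div, Real.rpow_inv_natCast_pow h0 (by omega)]

lemma base_nonneg {q δ : ℕ} (hq : 1 ≤ q) : 0 ≤ base q δ :=
  Real.rpow_nonneg (sub_nonneg.2 (one_le_pow₀ (by exact_mod_cast hq))) _

lemma base_lt {q δ : ℕ} (hq : 1 ≤ q) (hδ : 1 ≤ δ) : base q δ < q := by
  refine lt_of_pow_lt_pow_left₀ δ (by positivity) ?_
  rw [base_pow_self hq hδ]
  linarith

/-- All inequalities are compared after raising to the power δ, where the base becomes q^δ - 1. -/
lemma isBase_base {q δ : ℕ} (hq : 2 ≤ q) (hδ : 1 ≤ δ) : IsBase q δ (base q δ) := by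
  have hq1 : (1 : ℝ) ≤ q := by exact_mod_cast (by omega : 1 ≤ q)
  have h0 := base_nonneg (δ := δ) (show 1 ≤ q by omega)
  refine ⟨?_, (base_lt (by omega) hδ).le, fun k hk => ?_⟩
  · refine le_of_pow_le_pow_left₀ (n := δ) (by omega) h0 ?_
    rw [base_pow_self (by omega) hδ, one_pow]
    have h1 : (q : ℝ) ^ 1 ≤ (q : ℝ) ^ δ := pow_le_pow_right₀ hq1 hδ
    have h2 : (2 : ℝ) ≤ q := by exact_mod_cast hq
    linarith
  · refine le_of_pow_le_pow_left₀ (n := δ) (by omega) (by positivity) ?_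
    rw [← pow_mul, mul_comm, pow_mul, base_pow_self (by omega) hδ]
    exact pow_sub_one_pow_le hq1 hk

lemma base_pow {q : ℕ} (hq : 1 ≤ q) (δ p : ℕ) :
    base q δ ^ p = ((q : ℝ) ^ δ - 1) ^ ((p : ℝ) / δ) := by
  have h0 : (0 : ℝ) ≤ (q : ℝ) ^ δ - 1 :=
    sub_nonneg.2 (one_le_pow₀ (by exact_mod_cast hq))
  rw [base, ← Real.rpow_natCast, ← Real.rpow_mul h0]
  congr 1
  ring

end HubColoring

theorem theorem7p1 (q : ℕ) (hq : 3 ≤ q) (δ : ℕ) :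
    (∃ ε : ℝ, 0 < ε ∧
      ∀ σ : ℕ, HubColoring.SolvableInTime q σ δ (fun p => ((q : ℝ) - ε) ^ p)) ∧
    (1 ≤ δ →
      ∀ σ : ℕ, HubColoring.SolvableInTime q σ δ
        (fun p => ((q : ℝ) ^ δ - 1) ^ ((p : ℝ) / (δ : ℝ)))) := by
  -- The search needs δ ≥ 1; for δ = 0 the set is in particular a (σ, 1)-hub. This ε does not depend
  -- on σ.
  refine ⟨⟨q - HubColoring.base q (max δ 1), sub_pos.2 (HubColoring.base_lt (by omega) (by omega)),
    fun σ => ?_⟩, fun hδ σ => ?_⟩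
  · simp only [sub_sub_cancel]
    exact (HubColoring.solvableInTime_of_isBase (by omega) (by omega)
      (HubColoring.isBase_base (by omega) (by omega)) σ).mono (le_max_left δ 1)
  · simp only [← HubColoring.base_pow (show 1 ≤ q by omega)]
    exact HubColoring.solvableInTime_of_isBase (by omega) hδ
      (HubColoring.isBase_base (by omega) hδ) σ
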